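/- Let $E$ be a complex Hilbert space (of arbitrary dimension) with open unit ball $B_E$. For $a\in B_E$ let $P_a$ be the orthogonal projection of $E$ onto $\mathbb{C}a$, $Q_a=\mathrm{Id}-P_a$, $s_a=\sqrt{1-\|a\|^2}$, and let $\varphi_a(x)=(s_aQ_a+P_a)\big(\frac{a-x}{1-\langle x,a\rangle}\big)$, $x\in B_E$, be the Möbius transform of $B_E$. Let $\mathcal{B}(B_E)$ be the Bloch space, that is, the space of analytic functions $f:B_E\to\mathbb{C}$ with $\sup_{x\in B_E}(1-\|x\|^2)\|f'(x)\|<\infty$, endowed with the norm $|f(0)|+\sup_{x\in B_E}\|(f\circ\varphi_x)'(0)\|$. Let $\phi:B_E\to B_E$ be analytic, let $\mathcal{R}\phi(z)=\phi'(z)(z)$ be its radial derivative, and let $C_\phi:\mathcal{B}(B_E)\to\mathcal{B}(B_E)$, $C_\phi(f)=f\circ\phi$, be the composition operator with symbol $\phi$. Assume that for every $0<\delta<1$ the sets $$\{\phi(z): z\in B_E,\ \|\phi(z)\|\le\delta\}\quad\text{and}\quad\{(1-\|z\|^2)\mathcal{R}\phi(z): z\in B_E,\ \|\phi(z)\|\le\delta\}$$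 are relatively compact in $E$. Then $C_\phi$ is a compact operator on $\mathcal{B}(B_E)$ if and only if both $$(i)\quad \lim_{\|\phi(z)\|\to1}\frac{(1-\|z\|^2)\,\|\mathcal{R}\phi(z)\|}{\sqrt{1-\|\phi(z)\|^2}}=0\qquad\text{and}\qquad (ii)\quad \lim_{\|\phi(z)\|\to1}\frac{(1-\|z\|^2)\,|\langle\phi(z),\mathcal{R}\phi(z)\rangle|}{1-\|\phi(z)\|^2}=0 .$$ Here $\lim_{\|\phi(z)\|\to1}F(z)=0$ means that for every $\varepsilon>0$ there is $\delta<1$ such that $|F(z)|<\varepsilon$ for all $z\in B_E$ with $\|\phi(z)\|>\delta$ (in particular it holds trivially if $\sup_{z\in B_E}\|\phi(z)\|<1$). -/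

import Mathlib

open Metric Filter Topology

noncomputable section

namespace BlochBall

section Mobius

variable {E : Type*} [NormedAddCommGroup E] [InnerProductSpace ℂ E]

/-- `P_a = ‖a‖⁻² a ⊗ a`, the orthogonal projection onto the line spanned by `a`
(it is `0` for `a = 0`).  Mathlib's inner product is linear in the second variable, so
`inner ℂ a x` is `⟨x, a⟩` for the convention "linear in the first variable". -/
def lineProj (a : E) : E →L[ℂ] E :=
  ((‖a‖ ^ 2 : ℝ) : ℂ)⁻¹ • (innerSL ℂ a).smulRight a

/-- The linear map `P_a + s_a Q_a`, where `s_a = √(1 - ‖a‖²)` and `Q_a = Id - P_a`. -/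
def mobiusLin (a : E) : E →L[ℂ] E :=
  lineProj a + ((√(1 - ‖a‖ ^ 2) : ℝ) : ℂ) • (ContinuousLinearMap.id ℂ E - lineProj a)

/-- The Möbius transform `φ_a(x) = (s_a Q_a + P_a) ((a - x) / (1 - ⟨x, a⟩))` of the unit ball. -/
def mobius (a x : E) : E :=
  mobiusLin a ((1 - inner ℂ a x)⁻¹ • (a - x))

/-- The norm `‖(f ∘ φ_x)'(0)‖` of the invariant gradient of `f` at `x`. -/
def invGradNorm (f : E → ℂ) (x : E) : ℝ :=
  ‖fderiv ℂ (fun y => f (mobius x y)) 0‖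

/-- The radial derivative `R φ(z) = φ'(z)(z)`. -/
def radialDeriv (φ : E → E) (z : E) : E :=
  fderiv ℂ φ z z

lemma lineProj_apply (a v : E) :
    lineProj a v = (((‖a‖ ^ 2 : ℝ) : ℂ)⁻¹ * inner ℂ a v) • a := by
  simp [lineProj, smul_smul]

lemma inner_smul_eq (a v : E) :
    (inner ℂ a v : ℂ) • a = ((‖a‖ ^ 2 : ℝ) : ℂ) • lineProj a v := by
  by_cases ha : a = 0
  · simp [ha]
  · have : ((‖a‖ ^ 2 : ℝ) : ℂ) ≠ 0 := by
      exact_mod_cast pow_ne_zero 2 (norm_ne_zero_iff.mpr ha)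
    rw [lineProj_apply, smul_smul, mul_inv_cancel_left₀ this]

lemma inner_lineProj (a v : E) : inner ℂ a (lineProj a v) = inner ℂ a v := by
  by_cases ha : a = 0
  · simp [ha]
  · have : ((‖a‖ : ℝ) : ℂ) ≠ 0 := by
      exact_mod_cast (norm_ne_zero_iff.mpr ha)
    rw [lineProj_apply, inner_smul_right, inner_self_eq_norm_sq_to_K]
    push_cast
    simp only [Complex.coe_algebraMap]
    field_simp

lemma lineProj_lineProj (a v : E) : lineProj a (lineProj a v) = lineProj a v := by
  rw [lineProj_apply, inner_lineProj, ← lineProj_apply]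

lemma inner_sub_lineProj (a v : E) : inner ℂ a (v - lineProj a v) = 0 := by
  rw [inner_sub_right, inner_lineProj, sub_self]

lemma norm_lineProj_le (a v : E) : ‖lineProj a v‖ ≤ ‖v‖ := by
  by_cases ha : a = 0
  · simp [ha, lineProj]
  · have h0 : 0 < ‖a‖ := norm_pos_iff.mpr ha
    have h := norm_inner_le_norm (𝕜 := ℂ) a v
    rw [lineProj_apply, norm_smul, norm_mul, norm_inv, Complex.norm_real, Real.norm_eq_abs,
      abs_of_nonneg (by positivity)]
    calc (‖a‖ ^ 2)⁻¹ * ‖inner ℂ a v‖ * ‖a‖ ≤ (‖a‖ ^ 2)⁻¹ * (‖a‖ * ‖v‖) * ‖a‖ := by gcongr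
      _ = ‖v‖ := by field_simp

lemma one_sub_sq_pos {E : Type*} [NormedAddCommGroup E] {a : E} (ha : a ∈ ball (0 : E) 1) : 0 < 1 - ‖a‖ ^ 2 := by
  have h : ‖a‖ < 1 := by simpa using ha
  nlinarith [norm_nonneg a]

lemma hasFDerivAt_mobius (a : E) :
    HasFDerivAt (mobius a)
      ((mobiusLin a).comp ((innerSL ℂ a).smulRight a - ContinuousLinearMap.id ℂ E)) 0 := by
  have h1 : HasFDerivAt (fun x : E => (1 - inner ℂ a x : ℂ)) (-(innerSL ℂ a)) 0 := by
    have := ((innerSL ℂ a).hasFDerivAt (x := (0 : E))).const_sub (1 : ℂ)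
    simpa using this
  have h2 : HasFDerivAt (fun x : E => (1 - inner ℂ a x : ℂ)⁻¹) (innerSL ℂ a) 0 := by
    have h := (hasDerivAt_inv (x := (1 - inner ℂ a (0 : E) : ℂ)) (by simp)).comp_hasFDerivAt
      (0 : E) h1
    refine h.congr_fderiv ?_
    ext v
    simp
  have h3 : HasFDerivAt (fun x : E => a - x) (-(ContinuousLinearMap.id ℂ E)) 0 :=
    (hasFDerivAt_id (𝕜 := ℂ) (0 : E)).const_sub a
  have h4 := (mobiusLin a).hasFDerivAt.comp (0 : E) (h2.smul h3)
  refine h4.congr_fderiv ?_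
  ext v
  simp [sub_eq_add_neg, add_comm]

lemma mobius_zero (a : E) : mobius a 0 = a := by
  have h : lineProj a a = a := by
    by_cases ha : a = 0
    · simp [ha]
    · have : ((‖a‖ : ℝ) : ℂ) ≠ 0 := by
        exact_mod_cast (norm_ne_zero_iff.mpr ha)
      rw [lineProj_apply, inner_self_eq_norm_sq_to_K]
      push_cast
      simp only [Complex.coe_algebraMap]
      rw [inv_mul_cancel₀ (pow_ne_zero 2 this), one_smul]
  simp [mobius, mobiusLin, h]

/-- `φ_a'(0) = -s_a² P_a - s_a Q_a`. -/
lemma fderiv_mobius_apply (a v : E) :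
    fderiv ℂ (mobius a) 0 v =
      -(((1 - ‖a‖ ^ 2 : ℝ) : ℂ) • lineProj a v)
        - ((√(1 - ‖a‖ ^ 2) : ℝ) : ℂ) • (v - lineProj a v) := by
  rw [(hasFDerivAt_mobius a).fderiv]
  simp only [ContinuousLinearMap.comp_apply, sub_apply,
    ContinuousLinearMap.smulRight_apply, innerSL_apply_apply, ContinuousLinearMap.id_apply,
    mobiusLin, add_apply, smul_apply, inner_smul_eq,
    map_sub, map_smul, lineProj_lineProj]
  push_cast
  module

lemma fderiv_comp_mobius {f : E → ℂ} (hf : DifferentiableOn ℂ f (ball 0 1)) {a : E}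
    (ha : a ∈ ball (0 : E) 1) (v : E) :
    fderiv ℂ (fun y => f (mobius a y)) 0 v = fderiv ℂ f a (fderiv ℂ (mobius a) 0 v) := by
  have h1 : HasFDerivAt f (fderiv ℂ f a) (mobius a 0) := by
    rw [mobius_zero]
    exact (hf.differentiableAt (isOpen_ball.mem_nhds ha)).hasFDerivAt
  have h2 := h1.comp (0 : E) (hasFDerivAt_mobius a)
  have h3 := h2.fderiv
  simp only [Function.comp_def] at h3
  rw [h3, (hasFDerivAt_mobius a).fderiv]
  rfl

end Mobius

section Estimates

variable {E : Type*} [NormedAddCommGroup E] [InnerProductSpace ℂ E]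

lemma hasDerivAt_line {F : Type*} [NormedAddCommGroup F] [NormedSpace ℂ F] {f : E → F}
    {x w : E} {t : ℂ} (hf : DifferentiableAt ℂ f (x + t • w)) :
    HasDerivAt (fun t : ℂ => f (x + t • w)) (fderiv ℂ f (x + t • w) w) t := by
  have h : HasDerivAt (fun t : ℂ => x + t • w) w t := by
    simpa using ((hasDerivAt_id t).smul_const w).const_add x
  exact hf.hasFDerivAt.comp_hasDerivAt t h

lemma norm_add_smul_sq {x w : E} (hxw : inner ℂ x w = 0) (t : ℂ) :
    ‖x + t • w‖ ^ 2 = ‖x‖ ^ 2 + ‖t‖ ^ 2 * ‖w‖ ^ 2 := by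
  have h : inner ℂ x (t • w) = 0 := by rw [inner_smul_right, hxw, mul_zero]
  have := norm_add_sq_eq_norm_sq_add_norm_sq_of_inner_eq_zero x (t • w) h
  rw [norm_smul] at this
  nlinarith [this]

/-- In directions orthogonal to `x`, the derivative of a Bloch function at `x` is only of the
order `(1 - ‖x‖)^(-1/2)`. -/
lemma tangential_aux {f : E → ℂ} (hf : DifferentiableOn ℂ f (ball 0 1)) {M : ℝ}
    (hM : ∀ x ∈ ball (0 : E) 1, (1 - ‖x‖ ^ 2) * ‖fderiv ℂ f x‖ ≤ M) {w : E} (hw : ‖w‖ ≤ 1)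
    (n : ℕ) : ∀ x : E, (1 / 2 : ℝ) ^ n ≤ 1 - ‖x‖ → inner ℂ x w = 0 →
      ‖fderiv ℂ f x w‖ * √(1 - ‖x‖) ≤ 7 * M := by
  have hM0 : 0 ≤ M := le_trans (by simp) (hM 0 (by simp))
  have easy : ∀ x : E, ‖x‖ ≤ 1 / 2 → ‖fderiv ℂ f x w‖ * √(1 - ‖x‖) ≤ 7 * M := by
    intro x hx
    have h1 := hM x (by simp; linarith)
    have h2 : ‖fderiv ℂ f x w‖ ≤ ‖fderiv ℂ f x‖ :=
      ((fderiv ℂ f x).le_opNorm w).trans (mul_le_of_le_one_right (norm_nonneg _) hw)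
    have h3 : √(1 - ‖x‖) ≤ 1 := Real.sqrt_le_one.mpr (by linarith [norm_nonneg x])
    have h4 : ‖x‖ ^ 2 ≤ 1 / 4 := by nlinarith [norm_nonneg x]
    have h5 : ‖fderiv ℂ f x w‖ * √(1 - ‖x‖) ≤ ‖fderiv ℂ f x w‖ :=
      mul_le_of_le_one_right (norm_nonneg _) h3
    nlinarith [norm_nonneg (fderiv ℂ f x)]
  induction n with
  | zero =>
    intro x hx _
    apply easy
    simp at hx
    simp [hx]
  | succ n ih =>
    intro x hx hxw
    rcases le_or_gt ‖x‖ (1 / 2) with h | h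
    · exact easy x h
    set d : ℝ := 1 - ‖x‖ with hd
    have hd0 : 0 < d := lt_of_lt_of_le (by positivity) hx
    have hd1 : d < 1 / 2 := by linarith
    have hxd : ‖x‖ = 1 - d := by rw [hd]; ring
    set c : ℝ := (1 - 2 * d) / (1 - d) with hc
    have hc0 : 0 ≤ c := div_nonneg (by linarith) (by linarith)
    set x' : E := (c : ℂ) • x with hx'
    have hcx : c * (1 - d) = 1 - 2 * d := div_mul_cancel₀ _ (by linarith)
    have hnx' : ‖x'‖ = 1 - 2 * d := by
      rw [hx', norm_smul, Complex.norm_real, Real.norm_eq_abs, abs_of_nonneg hc0, hxd, hcx]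
    have hx'w : inner ℂ x' w = 0 := by rw [hx', inner_smul_left, hxw, mul_zero]
    have hxx' : ‖x - x'‖ ≤ d := by
      have h1 : x - x' = ((1 - c : ℝ) : ℂ) • x := by rw [hx']; push_cast; module
      have h2 : c ≤ 1 := (div_le_one (by linarith)).mpr (by linarith)
      rw [h1, norm_smul, Complex.norm_real, Real.norm_eq_abs, abs_of_nonneg (by linarith), hxd]
      nlinarith
    have hih := ih x' (by rw [hnx']; rw [pow_succ] at hx; linarith) hx'w
    rw [hnx'] at hih
    have hK : ∀ y ∈ closedBall (0 : E) (√(1 - d)), y ∈ ball (0 : E) 1 ∧ d ≤ 1 - ‖y‖ ^ 2 := by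
      intro y hy
      rw [mem_closedBall_zero_iff] at hy
      have h1 : ‖y‖ ^ 2 ≤ 1 - d := by
        calc ‖y‖ ^ 2 ≤ (√(1 - d)) ^ 2 := by gcongr
          _ = 1 - d := Real.sq_sqrt (by linarith)
      refine ⟨?_, by linarith⟩
      rw [mem_ball_zero_iff]
      nlinarith [norm_nonneg y]
    set r : ℝ := √d / 2 with hr
    have hsd : 0 < √d := Real.sqrt_pos.mpr hd0
    have hsd2 : √d ^ 2 = d := Real.sq_sqrt hd0.le
    have hr0 : 0 < r := by positivity
    have hmem : ∀ y : E, ‖y‖ ≤ 1 - d → inner ℂ y w = 0 → ∀ t : ℂ, ‖t‖ ≤ r →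
        y + t • w ∈ closedBall (0 : E) (√(1 - d)) := by
      intro y hy hyw t ht
      rw [mem_closedBall_zero_iff]
      apply Real.le_sqrt_of_sq_le
      rw [norm_add_smul_sq hyw]
      have h1 : ‖t‖ ^ 2 ≤ d / 4 := by
        calc ‖t‖ ^ 2 ≤ r ^ 2 := by gcongr
          _ = d / 4 := by rw [hr, div_pow, hsd2]; norm_num
      have h2 : ‖w‖ ^ 2 ≤ 1 := pow_le_one₀ (norm_nonneg _) hw
      have h3 : ‖y‖ ^ 2 ≤ (1 - d) ^ 2 := by gcongr
      have h4 : ‖t‖ ^ 2 * ‖w‖ ^ 2 ≤ d / 4 := by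
        calc ‖t‖ ^ 2 * ‖w‖ ^ 2 ≤ d / 4 * 1 := by gcongr
          _ = d / 4 := mul_one _
      nlinarith
    have hdiff : ∀ y ∈ closedBall (0 : E) (√(1 - d)), DifferentiableAt ℂ f y := fun y hy =>
      hf.differentiableAt (isOpen_ball.mem_nhds (hK y hy).1)
    have hbound : ∀ y ∈ closedBall (0 : E) (√(1 - d)), ‖fderiv ℂ f y‖ ≤ M / d := by
      intro y hy
      rw [le_div_iff₀ hd0]
      have h1 := hM y (hK y hy).1
      have h2 := (hK y hy).2
      nlinarith [norm_nonneg (fderiv ℂ f y)]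
    have hder : ∀ t : ℂ, ‖t‖ ≤ r →
        HasDerivAt (fun t : ℂ => f (x + t • w) - f (x' + t • w))
          (fderiv ℂ f (x + t • w) w - fderiv ℂ f (x' + t • w) w) t := fun t ht =>
      (hasDerivAt_line (hdiff _ (hmem x hxd.le hxw t ht))).sub
        (hasDerivAt_line (hdiff _ (hmem x' (by linarith) hx'w t ht)))
    have hC := Complex.norm_deriv_le_of_forall_mem_sphere_norm_le (c := (0 : ℂ)) (C := M) hr0
      (f := fun t : ℂ => f (x + t • w) - f (x' + t • w))
      (DifferentiableOn.diffContOnCl (fun t ht => by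
        have ht' : t ∈ closedBall (0 : ℂ) r := closure_ball_subset_closedBall ht
        rw [mem_closedBall_zero_iff] at ht'
        exact (hder t ht').differentiableAt.differentiableWithinAt))
      (fun t ht => by
        have ht' : ‖t‖ ≤ r := by rw [mem_sphere_zero_iff_norm] at ht; exact ht.le
        have h1 := (convex_closedBall (0 : E) (√(1 - d))).norm_image_sub_le_of_norm_fderiv_le
          hdiff hbound (hmem x' (by linarith) hx'w t ht') (hmem x hxd.le hxw t ht')
        calc _ ≤ M / d * ‖x + t • w - (x' + t • w)‖ := h1
          _ = M / d * ‖x - x'‖ := by congr 2; abel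
          _ ≤ M / d * d := by gcongr
          _ = M := div_mul_cancel₀ _ hd0.ne')
    rw [(hder 0 (by simpa using hr0.le)).deriv] at hC
    simp only [zero_smul, add_zero] at hC
    have h7 : ‖fderiv ℂ f x w‖ ≤ ‖fderiv ℂ f x' w‖ + M / r := by
      have := norm_sub_norm_le (fderiv ℂ f x w) (fderiv ℂ f x' w)
      linarith
    have h8 : √(1 - (1 - 2 * d)) = √2 * √d := by
      rw [← Real.sqrt_mul (by norm_num)]; congr 1; ring
    rw [h8] at hih
    have h9 : M / r * √d = 2 * M := by rw [hr]; field_simp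
    have h10 : (1.414 : ℝ) ≤ √2 := Real.le_sqrt_of_sq_le (by norm_num)
    have h11 : ‖fderiv ℂ f x' w‖ * √d * 1.414 ≤ 7 * M := by
      have : 0 ≤ ‖fderiv ℂ f x' w‖ * √d := by positivity
      nlinarith
    calc ‖fderiv ℂ f x w‖ * √d ≤ (‖fderiv ℂ f x' w‖ + M / r) * √d := by gcongr
      _ = ‖fderiv ℂ f x' w‖ * √d + 2 * M := by rw [add_mul, h9]
      _ ≤ 7 * M := by linarith

lemma tangential_bound {f : E → ℂ} (hf : DifferentiableOn ℂ f (ball 0 1)) {M : ℝ}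
    (hM : ∀ x ∈ ball (0 : E) 1, (1 - ‖x‖ ^ 2) * ‖fderiv ℂ f x‖ ≤ M) {x : E}
    (hx : x ∈ ball (0 : E) 1) {w : E} (hxw : inner ℂ x w = 0) :
    ‖fderiv ℂ f x w‖ * √(1 - ‖x‖ ^ 2) ≤ 10 * M * ‖w‖ := by
  have hM0 : 0 ≤ M := le_trans (by simp) (hM 0 (by simp))
  rw [mem_ball_zero_iff] at hx
  by_cases hw0 : w = 0
  · simp [hw0]
  have hwp : 0 < ‖w‖ := norm_pos_iff.mpr hw0
  obtain ⟨n, hn⟩ := exists_pow_lt_of_lt_one (sub_pos.mpr hx) (by norm_num : (1 / 2 : ℝ) < 1)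
  have h1 := tangential_aux hf hM (w := ((‖w‖⁻¹ : ℝ) : ℂ) • w)
    (by rw [norm_smul, Complex.norm_real, norm_inv, norm_norm, inv_mul_cancel₀ hwp.ne'])
    n x hn.le (by rw [inner_smul_right, hxw, mul_zero])
  rw [map_smul, norm_smul, Complex.norm_real, norm_inv, norm_norm, mul_assoc,
    inv_mul_le_iff₀ hwp] at h1
  have h2 : √(1 - ‖x‖ ^ 2) ≤ √2 * √(1 - ‖x‖) := by
    rw [← Real.sqrt_mul (by norm_num)]
    apply Real.sqrt_le_sqrt
    nlinarith [norm_nonneg x]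
  have h3 : √2 ≤ 10 / 7 := Real.sqrt_le_iff.mpr (by norm_num)
  calc ‖fderiv ℂ f x w‖ * √(1 - ‖x‖ ^ 2) ≤ ‖fderiv ℂ f x w‖ * (√2 * √(1 - ‖x‖)) := by gcongr
    _ = √2 * (‖fderiv ℂ f x w‖ * √(1 - ‖x‖)) := by ring
    _ ≤ 10 / 7 * (‖w‖ * (7 * M)) := by gcongr
    _ = 10 * M * ‖w‖ := by ring

lemma invGradNorm_le {f : E → ℂ} (hf : DifferentiableOn ℂ f (ball 0 1)) {M : ℝ}
    (hM : ∀ x ∈ ball (0 : E) 1, (1 - ‖x‖ ^ 2) * ‖fderiv ℂ f x‖ ≤ M) {x : E}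
    (hx : x ∈ ball (0 : E) 1) : invGradNorm f x ≤ 21 * M := by
  have hM0 : 0 ≤ M := le_trans (by simp) (hM 0 (by simp))
  have hs := one_sub_sq_pos hx
  refine ContinuousLinearMap.opNorm_le_bound _ (by positivity) fun v => ?_
  rw [fderiv_comp_mobius hf hx, fderiv_mobius_apply, map_sub, map_neg, map_smul, map_smul]
  have h1 := tangential_bound hf hM hx (inner_sub_lineProj x v)
  have h2 : ‖v - lineProj x v‖ ≤ 2 * ‖v‖ := by
    linarith [norm_sub_le v (lineProj x v), norm_lineProj_le x v]
  have h3 : ‖((1 - ‖x‖ ^ 2 : ℝ) : ℂ) • fderiv ℂ f x (lineProj x v)‖ ≤ M * ‖v‖ := by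
    rw [norm_smul, Complex.norm_real, Real.norm_eq_abs, abs_of_pos hs]
    calc (1 - ‖x‖ ^ 2) * ‖fderiv ℂ f x (lineProj x v)‖
        ≤ (1 - ‖x‖ ^ 2) * (‖fderiv ℂ f x‖ * ‖v‖) := by
          gcongr
          exact ((fderiv ℂ f x).le_opNorm _).trans (by gcongr; exact norm_lineProj_le x v)
      _ = (1 - ‖x‖ ^ 2) * ‖fderiv ℂ f x‖ * ‖v‖ := by ring
      _ ≤ M * ‖v‖ := by gcongr; exact hM x hx
  have h4 : ‖((√(1 - ‖x‖ ^ 2) : ℝ) : ℂ) • fderiv ℂ f x (v - lineProj x v)‖ ≤ 20 * M * ‖v‖ := by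
    rw [norm_smul, Complex.norm_real, Real.norm_eq_abs, abs_of_nonneg (Real.sqrt_nonneg _),
      mul_comm]
    nlinarith
  calc _ ≤ ‖-(((1 - ‖x‖ ^ 2 : ℝ) : ℂ) • fderiv ℂ f x (lineProj x v))‖
        + ‖((√(1 - ‖x‖ ^ 2) : ℝ) : ℂ) • fderiv ℂ f x (v - lineProj x v)‖ := norm_sub_le _ _
    _ ≤ 21 * M * ‖v‖ := by rw [norm_neg]; linarith

/-- The Schwarz-Pick inequality at the origin of the unit disk. -/
lemma norm_deriv_le_one_sub_sq {g : ℂ → ℂ} (hg : DifferentiableOn ℂ g (ball 0 1))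
    (hmaps : ∀ t ∈ ball (0 : ℂ) 1, ‖g t‖ < 1) : ‖deriv g 0‖ ≤ 1 - ‖g 0‖ ^ 2 := by
  have h0 : (0 : ℂ) ∈ ball (0 : ℂ) 1 := by simp
  set a : ℂ := g 0 with ha
  have ha1 : ‖a‖ < 1 := hmaps 0 h0
  have hden : ∀ t ∈ ball (0 : ℂ) 1, 1 - (starRingEnd ℂ) a * g t ≠ 0 := by
    intro t ht h
    have h1 : ‖(starRingEnd ℂ) a * g t‖ = 1 := by rw [← sub_eq_zero.mp h]; simp
    rw [norm_mul, RCLike.norm_conj] at h1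
    nlinarith [hmaps t ht, norm_nonneg a, norm_nonneg (g t)]
  set h : ℂ → ℂ := fun t => (g t - a) / (1 - (starRingEnd ℂ) a * g t) with hh
  have hd : DifferentiableOn ℂ h (ball 0 1) :=
    (hg.sub_const a).div ((hg.const_mul _).const_sub 1) hden
  have hh0 : h 0 = 0 := by simp [hh, ha]
  have hm : Set.MapsTo h (ball 0 1) (closedBall (h 0) 1) := by
    intro t ht
    rw [hh0, mem_closedBall_zero_iff, hh]
    simp only
    rw [norm_div, div_le_one (norm_pos_iff.mpr (hden t ht))]
    refine (pow_le_pow_iff_left₀ (norm_nonneg _) (norm_nonneg _) two_ne_zero).1 ?_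
    have e : ‖1 - (starRingEnd ℂ) a * g t‖ ^ 2 - ‖g t - a‖ ^ 2
        = (1 - ‖a‖ ^ 2) * (1 - ‖g t‖ ^ 2) := by
      simp only [← Complex.normSq_eq_norm_sq, Complex.normSq_apply, Complex.sub_re, Complex.sub_im,
        Complex.mul_re, Complex.mul_im, Complex.conj_re, Complex.conj_im, Complex.one_re,
        Complex.one_im]
      ring
    have h1 : 0 ≤ (1 - ‖a‖ ^ 2) * (1 - ‖g t‖ ^ 2) := by
      have := hmaps t ht
      apply mul_nonneg <;> nlinarith [norm_nonneg a, norm_nonneg (g t)]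
    linarith
  have hS := Complex.norm_deriv_le_div_of_mapsTo_ball hd hm (by norm_num)
  have hg0 : HasDerivAt g (deriv g 0) 0 :=
    (hg.differentiableAt (isOpen_ball.mem_nhds h0)).hasDerivAt
  have hder : HasDerivAt h (deriv g 0 / (1 - (starRingEnd ℂ) a * a)) 0 := by
    have := (hg0.sub_const a).div ((hg0.const_mul ((starRingEnd ℂ) a)).const_sub 1) (hden 0 h0)
    refine this.congr_deriv ?_
    have hne := hden 0 h0
    rw [← ha] at hne ⊢
    field_simp
    ring
  have e2 : (1 - (starRingEnd ℂ) a * a : ℂ) = ((1 - ‖a‖ ^ 2 : ℝ) : ℂ) := by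
    rw [mul_comm, Complex.mul_conj, Complex.normSq_eq_norm_sq]; push_cast; ring
  have hp : 0 < 1 - ‖a‖ ^ 2 := by nlinarith [norm_nonneg a]
  rw [hder.deriv, e2, norm_div, Complex.norm_real, Real.norm_eq_abs, abs_of_pos hp, div_one,
    div_le_one hp] at hS
  exact hS

lemma inner_fderiv_le {φ : E → E} (hφ : DifferentiableOn ℂ φ (ball 0 1))
    (hmaps : Set.MapsTo φ (ball 0 1) (ball 0 1)) {z : E} (hz : z ∈ ball (0 : E) 1) {v e : E}
    (hv : ‖v‖ ≤ 1) (he : ‖e‖ ≤ 1) :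
    (1 - ‖z‖) * ‖(inner ℂ e (fderiv ℂ φ z v) : ℂ)‖ ≤ 1 - ‖(inner ℂ e (φ z) : ℂ)‖ ^ 2 := by
  have hz1 : ‖z‖ < 1 := by simpa using hz
  set ρ : ℝ := 1 - ‖z‖ with hρ
  have hρ0 : 0 < ρ := by linarith
  have hmem : ∀ t ∈ ball (0 : ℂ) 1, z + t • ((ρ : ℂ) • v) ∈ ball (0 : E) 1 := by
    intro t ht
    rw [mem_ball_zero_iff] at ht ⊢
    have h1 : ‖t • ((ρ : ℂ) • v)‖ ≤ ‖t‖ * ρ := by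
      rw [norm_smul, norm_smul, Complex.norm_real, Real.norm_eq_abs, abs_of_pos hρ0]
      gcongr
      exact mul_le_of_le_one_right hρ0.le hv
    have h2 : ‖t‖ * ρ < ρ := mul_lt_of_lt_one_left hρ0 ht
    linarith [norm_add_le z (t • ((ρ : ℂ) • v))]
  have hder : ∀ t ∈ ball (0 : ℂ) 1, HasDerivAt
      (fun t : ℂ => (inner ℂ e (φ (z + t • ((ρ : ℂ) • v))) : ℂ))
      (inner ℂ e (fderiv ℂ φ (z + t • ((ρ : ℂ) • v)) ((ρ : ℂ) • v))) t := by
    intro t ht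
    exact (innerSL ℂ e).hasFDerivAt.comp_hasDerivAt t (hasDerivAt_line
      (hφ.differentiableAt (isOpen_ball.mem_nhds (hmem t ht))))
  have h := norm_deriv_le_one_sub_sq
    (fun t ht => (hder t ht).differentiableAt.differentiableWithinAt) (fun t ht => by
      have h1 := hmaps (hmem t ht)
      rw [mem_ball_zero_iff] at h1
      calc _ ≤ ‖e‖ * ‖φ (z + t • ((ρ : ℂ) • v))‖ := norm_inner_le_norm _ _
        _ ≤ 1 * ‖φ (z + t • ((ρ : ℂ) • v))‖ := by gcongr
        _ < 1 := by rwa [one_mul])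
  rw [(hder 0 (by simp)).deriv] at h
  simpa [inner_smul_right, abs_of_pos hρ0] using h

lemma norm_fderiv_self_map_le {φ : E → E} (hφ : DifferentiableOn ℂ φ (ball 0 1))
    (hmaps : Set.MapsTo φ (ball 0 1) (ball 0 1)) {z : E} (hz : z ∈ ball (0 : E) 1) {v : E}
    (hv : ‖v‖ ≤ 1) :
    (1 - ‖z‖) * ‖fderiv ℂ φ z v‖ ≤ 2 * √(1 - ‖φ z‖ ^ 2) := by
  have hz1 : ‖z‖ < 1 := by simpa using hz
  set ρ : ℝ := 1 - ‖z‖ with hρ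
  have hρ0 : 0 < ρ := by linarith
  set u := fderiv ℂ φ z v with hu
  have key : ∀ q : E, (∀ e : E, ‖(inner ℂ e q : ℂ)‖ ≤ ρ / 2 * ‖(inner ℂ e u : ℂ)‖
      + ‖(inner ℂ e (φ z) : ℂ)‖) → ‖q‖ ≤ 1 := by
    intro q hq
    by_cases hq0 : q = 0
    · simp [hq0]
    have hqp : 0 < ‖q‖ := norm_pos_iff.mpr hq0
    set e : E := ((‖q‖⁻¹ : ℝ) : ℂ) • q with he
    have hen : ‖e‖ ≤ 1 := by
      rw [he, norm_smul, Complex.norm_real, norm_inv, norm_norm, inv_mul_cancel₀ hqp.ne']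
    have h1 := inner_fderiv_le hφ hmaps hz hv hen
    have h2 := hq e
    have h3 : ‖(inner ℂ e q : ℂ)‖ = ‖q‖ := by
      rw [he, inner_smul_left, norm_mul, RCLike.norm_conj, Complex.norm_real, norm_inv, norm_norm,
        inner_self_eq_norm_sq_to_K]
      simp only [norm_pow, Complex.coe_algebraMap, Complex.norm_real, norm_norm]
      field_simp
    rw [← hu, ← hρ] at h1
    nlinarith [sq_nonneg (1 - ‖(inner ℂ e (φ z) : ℂ)‖)]
  have hscal : ∀ e : E, ‖(inner ℂ e (((ρ / 2 : ℝ) : ℂ) • u) : ℂ)‖ = ρ / 2 * ‖(inner ℂ e u : ℂ)‖ := by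
    intro e
    rw [inner_smul_right, norm_mul, Complex.norm_real, Real.norm_eq_abs,
      abs_of_pos (by positivity)]
  have hp := key (((ρ / 2 : ℝ) : ℂ) • u + φ z) (fun e => by
    rw [inner_add_right, ← hscal]; exact norm_add_le _ _)
  have hm := key (((ρ / 2 : ℝ) : ℂ) • u - φ z) (fun e => by
    rw [inner_sub_right, ← hscal]; exact norm_sub_le _ _)
  have hpar := parallelogram_law_with_norm ℂ (((ρ / 2 : ℝ) : ℂ) • u) (φ z)
  rw [norm_smul, Complex.norm_real, Real.norm_eq_abs, abs_of_pos (by positivity)] at hpar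
  have h1 : (ρ * ‖u‖ / 2) ^ 2 ≤ 1 - ‖φ z‖ ^ 2 := by
    nlinarith [norm_nonneg (((ρ / 2 : ℝ) : ℂ) • u + φ z),
      norm_nonneg (((ρ / 2 : ℝ) : ℂ) • u - φ z)]
  have h2 := Real.le_sqrt_of_sq_le h1
  linarith

lemma norm_lineProj_fderiv_le {φ : E → E} (hφ : DifferentiableOn ℂ φ (ball 0 1))
    (hmaps : Set.MapsTo φ (ball 0 1) (ball 0 1)) {z : E} (hz : z ∈ ball (0 : E) 1) {v : E}
    (hv : ‖v‖ ≤ 1) :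
    (1 - ‖z‖) * ‖lineProj (φ z) (fderiv ℂ φ z v)‖ ≤ 1 - ‖φ z‖ ^ 2 := by
  by_cases h0 : φ z = 0
  · simp [h0, lineProj]
  have hp : 0 < ‖φ z‖ := norm_pos_iff.mpr h0
  have h1 := inner_fderiv_le hφ hmaps hz hv (e := ((‖φ z‖⁻¹ : ℝ) : ℂ) • φ z)
    (by rw [norm_smul, Complex.norm_real, norm_inv, norm_norm, inv_mul_cancel₀ hp.ne'])
  rw [inner_smul_left, inner_smul_left, norm_mul, norm_mul, RCLike.norm_conj, Complex.norm_real,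
    norm_inv, norm_norm, inner_self_eq_norm_sq_to_K] at h1
  simp only [norm_pow, Complex.coe_algebraMap, Complex.norm_real, norm_norm] at h1
  have e1 : ‖φ z‖⁻¹ * ‖φ z‖ ^ 2 = ‖φ z‖ := by field_simp
  rw [e1] at h1
  rw [lineProj_apply, norm_smul, norm_mul, norm_inv, Complex.norm_real, Real.norm_eq_abs,
    abs_of_nonneg (by positivity)]
  convert h1 using 2
  field_simp

lemma bloch_comp_bound {f : E → ℂ} (hf : DifferentiableOn ℂ f (ball 0 1)) {M : ℝ}
    (hM : ∀ x ∈ ball (0 : E) 1, (1 - ‖x‖ ^ 2) * ‖fderiv ℂ f x‖ ≤ M) {φ : E → E}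
    (hφ : DifferentiableOn ℂ φ (ball 0 1)) (hmaps : Set.MapsTo φ (ball 0 1) (ball 0 1)) {z : E}
    (hz : z ∈ ball (0 : E) 1) :
    (1 - ‖z‖ ^ 2) * ‖fderiv ℂ (fun y => f (φ y)) z‖ ≤ 82 * M := by
  have hM0 : 0 ≤ M := le_trans (by simp) (hM 0 (by simp))
  have hz1 : ‖z‖ < 1 := by simpa using hz
  have hs := one_sub_sq_pos (hmaps hz)
  have hs' : 0 < √(1 - ‖φ z‖ ^ 2) := Real.sqrt_pos.mpr hs
  set ρ : ℝ := 1 - ‖z‖ with hρ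
  have hρ0 : 0 < ρ := by linarith
  have hD : fderiv ℂ (fun y => f (φ y)) z = (fderiv ℂ f (φ z)).comp (fderiv ℂ φ z) :=
    fderiv_comp z (hf.differentiableAt (isOpen_ball.mem_nhds (hmaps hz)))
      (hφ.differentiableAt (isOpen_ball.mem_nhds hz))
  have hB : ‖fderiv ℂ (fun y => f (φ y)) z‖ ≤ 41 * M / ρ := by
    refine ContinuousLinearMap.opNorm_le_of_unit_norm (by positivity) fun v hv => ?_
    rw [hD, ContinuousLinearMap.comp_apply, le_div_iff₀ hρ0]
    set u := fderiv ℂ φ z v with hu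
    have h1 : ρ * ‖lineProj (φ z) u‖ ≤ 1 - ‖φ z‖ ^ 2 :=
      norm_lineProj_fderiv_le hφ hmaps hz hv.le
    have h2 : ρ * ‖u‖ ≤ 2 * √(1 - ‖φ z‖ ^ 2) := norm_fderiv_self_map_le hφ hmaps hz hv.le
    have h3 := tangential_bound hf hM (hmaps hz) (inner_sub_lineProj (φ z) u)
    have h4 : ‖u - lineProj (φ z) u‖ ≤ 2 * ‖u‖ := by
      linarith [norm_sub_le u (lineProj (φ z) u), norm_lineProj_le (φ z) u]
    have h5 : ‖fderiv ℂ f (φ z) (lineProj (φ z) u)‖ * ρ ≤ M := by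
      calc ‖fderiv ℂ f (φ z) (lineProj (φ z) u)‖ * ρ
          ≤ (‖fderiv ℂ f (φ z)‖ * ‖lineProj (φ z) u‖) * ρ := by
            gcongr; exact (fderiv ℂ f (φ z)).le_opNorm _
        _ = (ρ * ‖lineProj (φ z) u‖) * ‖fderiv ℂ f (φ z)‖ := by ring
        _ ≤ (1 - ‖φ z‖ ^ 2) * ‖fderiv ℂ f (φ z)‖ := by gcongr
        _ ≤ M := hM _ (hmaps hz)
    have h6 : ‖fderiv ℂ f (φ z) (u - lineProj (φ z) u)‖ * ρ ≤ 40 * M := by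
      refine le_of_mul_le_mul_right ?_ hs'
      calc ‖fderiv ℂ f (φ z) (u - lineProj (φ z) u)‖ * ρ * √(1 - ‖φ z‖ ^ 2)
          = ‖fderiv ℂ f (φ z) (u - lineProj (φ z) u)‖ * √(1 - ‖φ z‖ ^ 2) * ρ := by ring
        _ ≤ 10 * M * (2 * ‖u‖) * ρ := by
            gcongr ?_ * ρ
            exact h3.trans (by gcongr)
        _ = 20 * M * (ρ * ‖u‖) := by ring
        _ ≤ 20 * M * (2 * √(1 - ‖φ z‖ ^ 2)) := by gcongr
        _ = 40 * M * √(1 - ‖φ z‖ ^ 2) := by ring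
    have h7 : fderiv ℂ f (φ z) u = fderiv ℂ f (φ z) (lineProj (φ z) u)
        + fderiv ℂ f (φ z) (u - lineProj (φ z) u) := by rw [← map_add]; congr 1; abel
    rw [h7]
    calc _ ≤ (‖fderiv ℂ f (φ z) (lineProj (φ z) u)‖
          + ‖fderiv ℂ f (φ z) (u - lineProj (φ z) u)‖) * ρ := by gcongr; exact norm_add_le _ _
      _ ≤ 41 * M := by linarith
  have h1 : 1 - ‖z‖ ^ 2 ≤ 2 * ρ := by nlinarith [norm_nonneg z]
  calc _ ≤ 2 * ρ * (41 * M / ρ) := by gcongr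
    _ = 82 * M := by field_simp; ring

end Estimates

section BlochSpace

/-- The Bloch functions on the open unit ball of `E`: holomorphic (complex Fréchet
differentiable) functions on the ball with `sup (1 - ‖x‖²) ‖f'(x)‖ < ∞`.  A function on the ball is
represented by its extension by zero to `E`, so that two members are equal iff they agree on
the ball. -/
def blochSubmodule (E : Type*) [NormedAddCommGroup E] [InnerProductSpace ℂ E] :
    Submodule ℂ (E → ℂ) where
  carrier := {f | DifferentiableOn ℂ f (ball 0 1) ∧ (∀ x, x ∉ ball (0 : E) 1 → f x = 0) ∧
    ∃ M : ℝ, ∀ x ∈ ball (0 : E) 1, (1 - ‖x‖ ^ 2) * ‖fderiv ℂ f x‖ ≤ M}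
  zero_mem' := by
    refine ⟨differentiableOn_const 0, fun _ _ => rfl, 0, fun x _ => ?_⟩
    have : fderiv ℂ (0 : E → ℂ) x = 0 := by simp
    simp [this]
  add_mem' := by
    rintro f g ⟨hf, hf0, M, hM⟩ ⟨hg, hg0, N, hN⟩
    refine ⟨hf.add hg, fun x hx => by simp [hf0 x hx, hg0 x hx], M + N, fun x hx => ?_⟩
    have hx' := isOpen_ball.mem_nhds hx
    rw [fderiv_add (hf.differentiableAt hx') (hg.differentiableAt hx')]
    have h1 := hM x hx
    have h2 := hN x hx
    have h3 := norm_add_le (fderiv ℂ f x) (fderiv ℂ g x)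
    have h4 := one_sub_sq_pos hx
    nlinarith
  smul_mem' := by
    rintro c f ⟨hf, hf0, M, hM⟩
    refine ⟨hf.const_smul c, fun x hx => by simp [hf0 x hx], ‖c‖ * M, fun x hx => ?_⟩
    have hx' := isOpen_ball.mem_nhds hx
    rw [fderiv_const_smul (hf.differentiableAt hx'), norm_smul]
    calc _ = ‖c‖ * ((1 - ‖x‖ ^ 2) * ‖fderiv ℂ f x‖) := by ring
      _ ≤ ‖c‖ * M := by gcongr; exact hM x hx

/-- The Bloch space of the open unit ball of `E`. -/
def BlochSpace (E : Type*) [NormedAddCommGroup E] [InnerProductSpace ℂ E] : Type _ :=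
  blochSubmodule E

variable {E : Type*} [NormedAddCommGroup E] [InnerProductSpace ℂ E]

instance : AddCommGroup (BlochSpace E) := inferInstanceAs (AddCommGroup (blochSubmodule E))

instance : Module ℂ (BlochSpace E) := inferInstanceAs (Module ℂ (blochSubmodule E))

/-- The underlying function of an element of the Bloch space. -/
def BlochSpace.toFun (f : BlochSpace E) : E → ℂ := Subtype.val (p := (· ∈ blochSubmodule E)) f

instance : CoeFun (BlochSpace E) (fun _ => E → ℂ) := ⟨BlochSpace.toFun⟩

/-- The invariant seminorm `‖f‖_inv = sup_x ‖(f ∘ φ_x)'(0)‖`. -/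
def invSeminorm (f : BlochSpace E) : ℝ :=
  ⨆ x : ball (0 : E) 1, invGradNorm f x

/-- The norm `‖f‖ = |f(0)| + ‖f‖_inv` of the Bloch space. -/
instance : Norm (BlochSpace E) := ⟨fun f => ‖f 0‖ + invSeminorm f⟩

lemma BlochSpace.norm_def (f : BlochSpace E) : ‖f‖ = ‖f 0‖ + invSeminorm f := rfl

lemma BlochSpace.add_apply (f g : BlochSpace E) (x : E) : (f + g) x = f x + g x := rfl

lemma BlochSpace.smul_apply (c : ℂ) (f : BlochSpace E) (x : E) : (c • f) x = c * f x := rfl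

lemma BlochSpace.differentiableOn (f : BlochSpace E) : DifferentiableOn ℂ f (ball 0 1) := f.2.1

lemma BlochSpace.ext_ball {f g : BlochSpace E} (h : ∀ x ∈ ball (0 : E) 1, f x = g x) : f = g := by
  apply Subtype.ext
  funext x
  by_cases hx : x ∈ ball (0 : E) 1
  · exact h x hx
  · exact (f.2.2.1 x hx).trans (g.2.2.1 x hx).symm

/-- The supremum that defines `‖f‖_inv` is finite for every Bloch function. -/
lemma bddAbove_invGradNorm (f : BlochSpace E) :
    BddAbove (Set.range fun x : ball (0 : E) 1 => invGradNorm f x) := by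
  obtain ⟨M, hM⟩ := f.2.2.2
  refine ⟨21 * M, ?_⟩
  rintro _ ⟨x, rfl⟩
  exact invGradNorm_le f.differentiableOn hM x.2

lemma invGradNorm_nonneg (f : E → ℂ) (x : E) : 0 ≤ invGradNorm f x := norm_nonneg _

lemma invGradNorm_le_invSeminorm (f : BlochSpace E) {x : E} (hx : x ∈ ball (0 : E) 1) :
    invGradNorm f x ≤ invSeminorm f :=
  le_ciSup (bddAbove_invGradNorm f) ⟨x, hx⟩

lemma invSeminorm_nonneg (f : BlochSpace E) : 0 ≤ invSeminorm f :=
  Real.iSup_nonneg fun _ => invGradNorm_nonneg _ _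

lemma differentiableAt_comp_mobius (f : BlochSpace E) {x : E} (hx : x ∈ ball (0 : E) 1) :
    DifferentiableAt ℂ (fun y => f (mobius x y)) 0 := by
  have h : DifferentiableAt ℂ f (mobius x 0) := by
    rw [mobius_zero]
    exact f.differentiableOn.differentiableAt (isOpen_ball.mem_nhds hx)
  exact h.comp (0 : E) (hasFDerivAt_mobius x).differentiableAt

lemma invSeminorm_add_le (f g : BlochSpace E) :
    invSeminorm (f + g) ≤ invSeminorm f + invSeminorm g := by
  have : Nonempty (ball (0 : E) 1) := ⟨⟨0, by simp⟩⟩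
  refine ciSup_le fun x => ?_
  have h : invGradNorm (f + g : BlochSpace E) x ≤ invGradNorm f x + invGradNorm g x := by
    have h1 : (fun y => (f + g : BlochSpace E) (mobius x y))
        = (fun y => f (mobius x y)) + fun y => g (mobius x y) := rfl
    rw [invGradNorm, h1, fderiv_add (differentiableAt_comp_mobius f x.2)
      (differentiableAt_comp_mobius g x.2)]
    exact norm_add_le _ _
  exact h.trans (add_le_add (invGradNorm_le_invSeminorm f x.2) (invGradNorm_le_invSeminorm g x.2))

lemma invSeminorm_smul (c : ℂ) (f : BlochSpace E) :
    invSeminorm (c • f) = ‖c‖ * invSeminorm f := by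
  rw [invSeminorm, invSeminorm, Real.mul_iSup_of_nonneg (norm_nonneg c)]
  congr 1
  funext x
  have h1 : (fun y => (c • f : BlochSpace E) (mobius x y)) = c • fun y => f (mobius x y) := rfl
  rw [invGradNorm, h1, fderiv_const_smul (differentiableAt_comp_mobius f x.2), norm_smul]
  rfl

lemma BlochSpace.eq_zero_of_norm_eq_zero (f : BlochSpace E) (h : ‖f‖ = 0) : f = 0 := by
  have h0 : ‖f 0‖ = 0 := by
    have := BlochSpace.norm_def f
    linarith [norm_nonneg (f 0), invSeminorm_nonneg f]
  have hi : invSeminorm f = 0 := by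
    have := BlochSpace.norm_def f
    linarith [norm_nonneg (f 0), invSeminorm_nonneg f]
  have hd : ∀ x ∈ ball (0 : E) 1, fderiv ℂ f x = 0 := by
    intro x hx
    have h1 : fderiv ℂ (fun y => f (mobius x y)) 0 = 0 := norm_eq_zero.mp
      (le_antisymm (hi ▸ invGradNorm_le_invSeminorm f hx) (norm_nonneg _))
    have hs := one_sub_sq_pos hx
    have hs1 : ((1 - ‖x‖ ^ 2 : ℝ) : ℂ) ≠ 0 := by exact_mod_cast hs.ne'
    have hs2 : ((√(1 - ‖x‖ ^ 2) : ℝ) : ℂ) ≠ 0 := by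
      exact_mod_cast (Real.sqrt_pos.mpr hs).ne'
    ext w
    set v : E := -(((1 - ‖x‖ ^ 2 : ℝ) : ℂ)⁻¹ • lineProj x w)
        - ((√(1 - ‖x‖ ^ 2) : ℝ) : ℂ)⁻¹ • (w - lineProj x w) with hv
    have hPv : lineProj x v = -(((1 - ‖x‖ ^ 2 : ℝ) : ℂ)⁻¹ • lineProj x w) := by
      rw [hv, map_sub, map_neg, map_smul, map_smul, map_sub, lineProj_lineProj, sub_self,
        smul_zero, sub_zero]
    have h3 : fderiv ℂ (mobius x) 0 v = w := by
      rw [fderiv_mobius_apply, hPv, hv, sub_sub_cancel_left, smul_neg, smul_neg, neg_neg, sub_neg_eq_add,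
        smul_inv_smul₀ hs1, smul_inv_smul₀ hs2]
      abel
    have h2 := fderiv_comp_mobius f.differentiableOn hx v
    rw [h1, h3] at h2
    exact h2.symm
  refine BlochSpace.ext_ball fun x hx => ?_
  have h3 := (convex_ball (0 : E) 1).norm_image_sub_le_of_norm_fderiv_le (𝕜 := ℂ) (C := 0)
    (fun y hy => f.differentiableOn.differentiableAt (isOpen_ball.mem_nhds hy))
    (fun y hy => by rw [hd y hy, norm_zero]) (by simp : (0 : E) ∈ ball (0 : E) 1) hx
  rw [zero_mul, norm_le_zero_iff, norm_eq_zero.mp h0, sub_zero] at h3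
  exact h3

lemma blochCore : NormedSpace.Core ℂ (BlochSpace E) where
  norm_nonneg f := add_nonneg (norm_nonneg _) (invSeminorm_nonneg f)
  norm_smul c f := by
    rw [BlochSpace.norm_def, BlochSpace.norm_def, invSeminorm_smul, BlochSpace.smul_apply,
      norm_mul, mul_add]
  norm_triangle f g := by
    rw [BlochSpace.norm_def, BlochSpace.norm_def, BlochSpace.norm_def, BlochSpace.add_apply]
    linarith [norm_add_le (f 0) (g 0), invSeminorm_add_le f g]
  norm_eq_zero_iff f := by
    refine ⟨BlochSpace.eq_zero_of_norm_eq_zero f, ?_⟩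
    rintro rfl
    have h := invSeminorm_smul (0 : ℂ) (0 : BlochSpace E)
    rw [zero_smul, norm_zero, zero_mul] at h
    rw [BlochSpace.norm_def, h, add_zero]
    exact norm_zero

instance : NormedAddCommGroup (BlochSpace E) := NormedAddCommGroup.ofCore blochCore

instance : NormedSpace ℂ (BlochSpace E) := NormedSpace.ofCore blochCore

lemma comp_mem_bloch (f : BlochSpace E) {φ : E → E} (hφ : DifferentiableOn ℂ φ (ball 0 1))
    (hmaps : Set.MapsTo φ (ball 0 1) (ball 0 1)) :
    (ball (0 : E) 1).indicator (fun z => f (φ z)) ∈ blochSubmodule E := by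
  have heq : ∀ x ∈ ball (0 : E) 1,
      (ball (0 : E) 1).indicator (fun z => f (φ z)) =ᶠ[𝓝 x] fun z => f (φ z) := fun x hx =>
    Filter.mem_of_superset (isOpen_ball.mem_nhds hx) fun y hy => Set.indicator_of_mem hy _
  obtain ⟨M, hM⟩ := f.2.2.2
  refine ⟨fun x hx => ?_, fun x hx => Set.indicator_of_notMem hx _, 82 * M, fun x hx => ?_⟩
  · have h := (f.differentiableOn.comp hφ hmaps).differentiableAt (isOpen_ball.mem_nhds hx)
    exact (h.congr_of_eventuallyEq (heq x hx)).differentiableWithinAt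
  · rw [(heq x hx).fderiv_eq]
    exact bloch_comp_bound f.differentiableOn hM hφ hmaps hx

/-- `f ∘ φ` as an element of the Bloch space. -/
def BlochSpace.comp (f : BlochSpace E) (φ : E → E) (hφ : DifferentiableOn ℂ φ (ball 0 1))
    (hmaps : Set.MapsTo φ (ball 0 1) (ball 0 1)) : BlochSpace E :=
  Subtype.mk ((ball (0 : E) 1).indicator fun z => f (φ z)) (comp_mem_bloch f hφ hmaps)

lemma BlochSpace.comp_apply (f : BlochSpace E) (φ : E → E)
    (hφ : DifferentiableOn ℂ φ (ball 0 1)) (hmaps : Set.MapsTo φ (ball 0 1) (ball 0 1)) {z : E}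
    (hz : z ∈ ball (0 : E) 1) : f.comp φ hφ hmaps z = f (φ z) :=
  Set.indicator_of_mem hz fun z => f (φ z)

/-- The composition operator `C_φ(f) = f ∘ φ` on the Bloch space, for a holomorphic self-map `φ`
of the open unit ball. -/
def compositionOperator (φ : E → E) (hφ : DifferentiableOn ℂ φ (ball 0 1))
    (hmaps : Set.MapsTo φ (ball 0 1) (ball 0 1)) : BlochSpace E →ₗ[ℂ] BlochSpace E where
  toFun f := f.comp φ hφ hmaps
  map_add' f g := BlochSpace.ext_ball fun x hx => by
    simp only [BlochSpace.add_apply, BlochSpace.comp_apply _ φ hφ hmaps hx]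
  map_smul' c f := BlochSpace.ext_ball fun x hx => by
    simp only [RingHom.id_apply, BlochSpace.smul_apply, BlochSpace.comp_apply _ φ hφ hmaps hx]

lemma compositionOperator_apply (φ : E → E) (hφ : DifferentiableOn ℂ φ (ball 0 1))
    (hmaps : Set.MapsTo φ (ball 0 1) (ball 0 1)) (f : BlochSpace E) {z : E}
    (hz : z ∈ ball (0 : E) 1) : compositionOperator φ hφ hmaps f z = f (φ z) :=
  f.comp_apply φ hφ hmaps hz

/-- The statement `F(z) → 0` as `‖φ(z)‖ → 1`, `z` in the open unit ball. -/
def TendstoZeroAtBoundary (φ : E → E) (F : E → ℝ) : Prop :=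
  ∀ ε > 0, ∃ δ < 1, ∀ z ∈ ball (0 : E) 1, δ < ‖φ z‖ → |F z| < ε

end BlochSpace

end BlochBall

end

/-! For a Bloch function f, the radial derivative of f ∘ φ at z is f'(φ z)(Rφ(z)). Two facts tie the
Bloch norm to this number. First, a bound on (1 - ‖z‖²)|Rg(z)| over the ball already bounds (1 -
‖x‖²)‖g'(x)‖ (`norm_fderiv_le_of_radial`), so ‖C_φ f‖ is controlled by |f(φ 0)| and the supremum of
|f'(φ z)((1 - ‖z‖²)Rφ(z))|. Second, φ_x'(0) scales by 1 - ‖x‖² along x and by √(1 - ‖x‖²) across it,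
up to sign, so f'(x) is at most of order ‖f‖/(1 - ‖x‖²) along x and ‖f‖/√(1 - ‖x‖²) across it
(`BlochSpace.norm_fderiv_apply_le`).

Sufficiency. Where ‖φ z‖ > δ, the limits (ii) and (i) match these two rates and make the quantity at
most ε‖f‖. Where ‖φ z‖ ≤ δ, the pairs (φ z, (1 - ‖z‖²)Rφ(z)) form a relatively compact set on which
(x, y) ↦ f'(x)y is Lipschitz, uniformly for ‖f‖ ≤ 1. Hence the value f(φ 0) and finitely many
numbers f'(x_i)y_i determine C_φ f up to a small error: the image of the unit ball is totally
bounded, and the Bloch space is complete.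

Necessity. A compact C_φ sends bounded, pointwise null sequences to norm null sequences. With a = φ
z and w ⟂ a, the functions (1 - ‖a‖²)/(1 - ⟨x, a⟩) and √(1 - ‖a‖²)⟨x, w⟩/(1 - ⟨x, a⟩) are bounded in
norm, tend to 0 pointwise as ‖a‖ → 1, and have derivatives ⟨u, a⟩/(1 - ‖a‖²) and ⟨u, w⟩/√(1 - ‖a‖²)
at a. The first family yields (ii). The second, with w along the part of Rφ(z) orthogonal to a,
yields (i) once (ii) is known. -/

namespace BlochBall

/-! ### Growth of the full derivative from growth of the radial derivative -/

section RadialGrowth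

variable {E : Type*} [NormedAddCommGroup E] [InnerProductSpace ℂ E]

/-- The Cauchy estimate for the Fréchet derivative. -/
lemma norm_le_of_hasFDerivAt {F : E → ℂ} {F' : E →L[ℂ] ℂ} {x : E} {r C : ℝ} (hr : 0 < r)
    (hd : DifferentiableOn ℂ F (ball x r)) (hF' : HasFDerivAt F F' x)
    (hC : ∀ y ∈ ball x r, ‖F y‖ ≤ C) : ‖F'‖ ≤ 2 * C / r := by
  rw [← hF'.fderiv]
  refine Complex.norm_fderiv_le_div_of_mapsTo_ball hd (fun y hy => ?_) hr
  rw [mem_closedBall, dist_eq_norm]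
  linarith [norm_sub_le (F y) (F x), hC y hy, hC x (mem_ball_self hr)]

variable {g : E → ℂ} {M : ℝ}

lemma nonneg_of_radial_bound
    (hM : ∀ z ∈ ball (0 : E) 1, (1 - ‖z‖ ^ 2) * ‖fderiv ℂ g z z‖ ≤ M) : 0 ≤ M :=
  le_trans (by simp) (hM 0 (by simp))

/-- A bound on the radial derivative controls the derivative of the restriction to each complex
line through the origin. -/
lemma norm_fderiv_line_le (hg : DifferentiableOn ℂ g (ball 0 1))
    (hM : ∀ z ∈ ball (0 : E) 1, (1 - ‖z‖ ^ 2) * ‖fderiv ℂ g z z‖ ≤ M) {u : E} (hu : ‖u‖ = 1)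
    {t : ℂ} (ht : ‖t‖ < 1) : (1 - ‖t‖ ^ 2) * ‖fderiv ℂ g (t • u) u‖ ≤ 4 * M := by
  have hM0 := nonneg_of_radial_bound hM
  have hnorm : ∀ s : ℂ, ‖s • u‖ = ‖s‖ := fun s => by rw [norm_smul, hu, mul_one]
  have hmem : ∀ s : ℂ, ‖s‖ < 1 → s • u ∈ ball (0 : E) 1 := fun s hs => by
    rwa [mem_ball_zero_iff, hnorm]
  have hline : ∀ s : ℂ, ‖s‖ < 1 → ‖s‖ * ((1 - ‖s‖ ^ 2) * ‖fderiv ℂ g (s • u) u‖) ≤ M := by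
    intro s hs
    have h := hM _ (hmem s hs)
    rw [hnorm, map_smul, norm_smul] at h
    linarith
  have hnn : ∀ s : ℂ, ‖s‖ < 1 → 0 ≤ (1 - ‖s‖ ^ 2) * ‖fderiv ℂ g (s • u) u‖ := fun s hs =>
    mul_nonneg (by nlinarith [norm_nonneg s]) (norm_nonneg _)
  -- The radial derivative at `t • u` carries a factor `t`, which can be divided out only away from
  -- 0. Inside the disk of radius 1/2 the maximum principle takes over.
  rcases le_or_gt (1 / 2) ‖t‖ with h | h
  · nlinarith [hline t ht, hnn t ht]
  have hder : ∀ s ∈ ball (0 : ℂ) 1,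
      HasDerivAt (fun s : ℂ => g (s • u)) (fderiv ℂ g (s • u) u) s := by
    intro s hs
    have hs' := hmem s (by simpa using hs)
    have := hasDerivAt_line (f := g) (x := (0 : E)) (w := u) (t := s)
      (by rw [zero_add]; exact hg.differentiableAt (isOpen_ball.mem_nhds hs'))
    simpa using this
  have hk : DifferentiableOn ℂ (fun s : ℂ => fderiv ℂ g (s • u) u) (ball 0 1) := by
    have h1 : DifferentiableOn ℂ (fun s : ℂ => g (s • u)) (ball 0 1) := fun s hs =>
      (hder s hs).differentiableAt.differentiableWithinAt
    exact (h1.deriv isOpen_ball).congr fun s hs => (hder s hs).deriv.symm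
  -- On the circle of radius 1/2 the weight |s|(1 - |s|²) equals 3/8, hence 8/3.
  have hmax := Complex.norm_le_of_forall_mem_frontier_norm_le (U := ball (0 : ℂ) (1 / 2))
    (C := 8 / 3 * M) isBounded_ball
    (DifferentiableOn.diffContOnCl (hk.mono
      (closure_ball_subset_closedBall.trans (closedBall_subset_ball (by norm_num)))))
    (fun s hs => by
      have hs' : ‖s‖ = 1 / 2 := by
        rw [frontier_ball _ (by norm_num)] at hs
        simpa using hs
      have := hline s (by rw [hs']; norm_num)
      rw [hs'] at this
      nlinarith)
    (subset_closure (by simpa using h))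
  have h1 : 1 - ‖t‖ ^ 2 ≤ 1 := by nlinarith [norm_nonneg t]
  calc (1 - ‖t‖ ^ 2) * ‖fderiv ℂ g (t • u) u‖ ≤ 1 * ‖fderiv ℂ g (t • u) u‖ := by gcongr
    _ ≤ 4 * M := by linarith

/-- Mean value inequality for t ↦ g(tx) between t = c and t = 1; its derivative is bounded by
`norm_fderiv_line_le`, since ‖tx‖ ≤ ‖x‖ only improves the weight. -/
lemma norm_sub_smul_le (hg : DifferentiableOn ℂ g (ball 0 1))
    (hM : ∀ z ∈ ball (0 : E) 1, (1 - ‖z‖ ^ 2) * ‖fderiv ℂ g z z‖ ≤ M) {x : E}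
    (hx : x ∈ ball (0 : E) 1) {c : ℝ} (hc0 : 0 ≤ c) (hc1 : c ≤ 1) :
    ‖g x - g ((c : ℂ) • x)‖ ≤ 4 * M / (1 - ‖x‖ ^ 2) * (1 - c) := by
  have hM0 := nonneg_of_radial_bound hM
  have hs := one_sub_sq_pos hx
  rw [mem_ball_zero_iff] at hx
  by_cases hx0 : x = 0
  · simp only [hx0, smul_zero, sub_self, norm_zero]
    have : 0 ≤ 1 - c := by linarith
    norm_num
    positivity
  have hxp : 0 < ‖x‖ := norm_pos_iff.mpr hx0
  have hxc : ((‖x‖ : ℝ) : ℂ) ≠ 0 := by exact_mod_cast hxp.ne'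
  set u : E := ((‖x‖ : ℝ) : ℂ)⁻¹ • x with hu
  have hu1 : ‖u‖ = 1 := by
    rw [hu, norm_smul, norm_inv, Complex.norm_real, norm_norm, inv_mul_cancel₀ hxp.ne']
  have hxu : x = ((‖x‖ : ℝ) : ℂ) • u := by rw [hu, smul_inv_smul₀ hxc]
  have hnorm : ∀ t : ℂ, ‖t‖ ≤ 1 → ‖t • x‖ ≤ ‖x‖ := fun t ht => by
    rw [norm_smul]
    exact mul_le_of_le_one_left hxp.le ht
  have hder : ∀ t ∈ closedBall (0 : ℂ) 1, HasDerivWithinAt (fun t : ℂ => g (t • x))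
      (fderiv ℂ g (t • x) x) (closedBall 0 1) t := by
    intro t ht
    rw [mem_closedBall_zero_iff] at ht
    have := hasDerivAt_line (f := g) (x := (0 : E)) (w := x) (t := t)
      (by rw [zero_add]
          exact hg.differentiableAt (isOpen_ball.mem_nhds
            (by rw [mem_ball_zero_iff]; exact (hnorm t ht).trans_lt hx)))
    simp only [zero_add] at this
    exact this.hasDerivWithinAt
  have hbd : ∀ t ∈ closedBall (0 : ℂ) 1, ‖fderiv ℂ g (t • x) x‖ ≤ 4 * M / (1 - ‖x‖ ^ 2) := by
    intro t ht
    rw [mem_closedBall_zero_iff] at ht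
    have h2 : ‖t * ((‖x‖ : ℝ) : ℂ)‖ ≤ ‖x‖ := by
      have := hnorm t ht
      rw [norm_smul] at this
      rwa [norm_mul, Complex.norm_real, norm_norm]
    have h1 := norm_fderiv_line_le hg hM hu1 (t := t * ((‖x‖ : ℝ) : ℂ)) (h2.trans_lt hx)
    have h3 : fderiv ℂ g (t • x) x
        = ((‖x‖ : ℝ) : ℂ) • fderiv ℂ g ((t * ((‖x‖ : ℝ) : ℂ)) • u) u := by
      rw [mul_smul, ← hxu, ← map_smul, ← hxu]
    rw [h3, norm_smul, Complex.norm_real, norm_norm, le_div_iff₀ hs]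
    set D := ‖fderiv ℂ g ((t * ((‖x‖ : ℝ) : ℂ)) • u) u‖
    have h4 : ‖t * ((‖x‖ : ℝ) : ℂ)‖ ^ 2 ≤ ‖x‖ ^ 2 := by gcongr
    calc ‖x‖ * D * (1 - ‖x‖ ^ 2) ≤ 1 * D * (1 - ‖t * ((‖x‖ : ℝ) : ℂ)‖ ^ 2) := by gcongr
      _ ≤ 4 * M := by linarith
  have h := (convex_closedBall (0 : ℂ) 1).norm_image_sub_le_of_norm_hasDerivWithin_le hder hbd
    (x := (c : ℂ)) (y := 1) (by simpa [abs_of_nonneg hc0] using hc1) (by simp)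
  have h5 : ‖(1 : ℂ) - (c : ℂ)‖ = 1 - c := by
    rw [← Complex.ofReal_one, ← Complex.ofReal_sub, Complex.norm_real, Real.norm_eq_abs,
      abs_of_nonneg (by linarith)]
  rwa [one_smul, h5] at h

/-- Induction on dyadic distance to the sphere. With d = 1 - ‖x‖, the point x is compared with the
point cx at distance 2d from the sphere. The function y ↦ g(y) - g(cy) is O(M) near x, so by Cauchy
its derivative there is O(M/d). Doubling the distance halves the inherited bound: 64 M from the
induction hypothesis plus 64 M from Cauchy reproduces 128 M. -/
lemma norm_fderiv_le_of_radial_aux (hg : DifferentiableOn ℂ g (ball 0 1))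
    (hM : ∀ z ∈ ball (0 : E) 1, (1 - ‖z‖ ^ 2) * ‖fderiv ℂ g z z‖ ≤ M) (n : ℕ) :
    ∀ x : E, (1 / 2 : ℝ) ^ n ≤ 1 - ‖x‖ → (1 - ‖x‖) * ‖fderiv ℂ g x‖ ≤ 128 * M := by
  have hM0 := nonneg_of_radial_bound hM
  have easy : ∀ x : E, ‖x‖ ≤ 1 / 2 → (1 - ‖x‖) * ‖fderiv ℂ g x‖ ≤ 128 * M := by
    intro x hx
    have hsub : ∀ y ∈ ball x (1 / 4), ‖y‖ ≤ 3 / 4 := by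
      intro y hy
      rw [mem_ball, dist_eq_norm] at hy
      linarith [norm_sub_norm_le y x]
    have hsub' : ∀ y ∈ ball x (1 / 4), y ∈ ball (0 : E) 1 := fun y hy => by
      rw [mem_ball_zero_iff]; linarith [hsub y hy]
    -- On this ball ‖y‖ ≤ 3/4, so comparison with g(0) costs at most 4M/(7/16) ≤ 10 M.
    have h := norm_le_of_hasFDerivAt (F := fun y => g y - g 0) (C := 10 * M) (r := 1 / 4)
      (by norm_num) (fun y hy => ((hg.differentiableAt (isOpen_ball.mem_nhds
        (hsub' y hy))).sub_const _).differentiableWithinAt)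
      ((hg.differentiableAt (isOpen_ball.mem_nhds
        (hsub' x (mem_ball_self (by norm_num))))).hasFDerivAt.sub_const _)
      (fun y hy => by
        have h1 := norm_sub_smul_le hg hM (hsub' y hy) le_rfl zero_le_one
        rw [Complex.ofReal_zero, zero_smul] at h1
        refine h1.trans ?_
        have h2 : ‖y‖ ^ 2 ≤ (3 / 4) ^ 2 := by gcongr; exact hsub y hy
        rw [sub_zero, mul_one, div_le_iff₀ (by linarith)]
        nlinarith)
    have h3 : 2 * (10 * M) / (1 / 4) = 80 * M := by ring
    rw [h3] at h
    nlinarith [norm_nonneg (fderiv ℂ g x), norm_nonneg x]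
  induction n with
  | zero =>
    intro x hx
    apply easy
    simp at hx
    simp [hx]
  | succ n ih =>
    intro x hx
    rcases le_or_gt ‖x‖ (1 / 2) with h | h
    · exact easy x h
    set d : ℝ := 1 - ‖x‖ with hd
    have hd0 : 0 < d := lt_of_lt_of_le (by positivity) hx
    have hxd : ‖x‖ = 1 - d := by rw [hd]; ring
    -- Chosen so that ‖cx‖ = 1 - 2d.
    set c : ℝ := (1 - 2 * d) / (1 - d) with hc
    have hc0 : 0 ≤ c := div_nonneg (by linarith) (by linarith)
    have hc1 : c ≤ 1 := (div_le_one (by linarith)).mpr (by linarith)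
    have hcx : c * (1 - d) = 1 - 2 * d := div_mul_cancel₀ _ (by linarith)
    have hcn : ‖(c : ℂ) • x‖ = 1 - 2 * d := by
      rw [norm_smul, Complex.norm_real, Real.norm_eq_abs, abs_of_nonneg hc0, hxd, hcx]
    have hsub : ∀ y ∈ ball x (d / 2), ‖y‖ ≤ 1 - d / 2 := by
      intro y hy
      rw [mem_ball, dist_eq_norm] at hy
      linarith [norm_sub_norm_le y x]
    have hdiff : ∀ y ∈ ball x (d / 2), ∀ b : ℝ, 0 ≤ b → b ≤ 1 →
        DifferentiableAt ℂ g ((b : ℂ) • y) := by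
      intro y hy b hb0 hb1
      refine hg.differentiableAt (isOpen_ball.mem_nhds ?_)
      rw [mem_ball_zero_iff, norm_smul, Complex.norm_real, Real.norm_eq_abs, abs_of_nonneg hb0]
      nlinarith [hsub y hy, norm_nonneg y]
    have hder : ∀ y ∈ ball x (d / 2), HasFDerivAt (fun y => g y - g ((c : ℂ) • y))
        (fderiv ℂ g y - (fderiv ℂ g ((c : ℂ) • y)).comp ((c : ℂ) • ContinuousLinearMap.id ℂ E))
        y := by
      intro y hy
      have h1 := hdiff y hy 1 zero_le_one le_rfl
      rw [Complex.ofReal_one, one_smul] at h1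
      exact h1.hasFDerivAt.sub ((hdiff y hy c hc0 hc1).hasFDerivAt.comp y
        ((hasFDerivAt_id y).const_smul (c : ℂ)))
    have hC := norm_le_of_hasFDerivAt (C := 16 * M) (r := d / 2) (by linarith)
      (fun y hy => (hder y hy).differentiableAt.differentiableWithinAt)
      (hder x (mem_ball_self (by linarith)))
      (fun y hy => by
        have h0 := hsub y hy
        have hy1 : y ∈ ball (0 : E) 1 := by rw [mem_ball_zero_iff]; linarith
        have h1 := norm_sub_smul_le hg hM hy1 hc0 hc1
        refine h1.trans ?_
        have h2 : d / 2 ≤ 1 - ‖y‖ ^ 2 := by nlinarith [norm_nonneg y]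
        have h3 : 1 - c ≤ 2 * d := by nlinarith
        calc 4 * M / (1 - ‖y‖ ^ 2) * (1 - c) ≤ 4 * M / (d / 2) * (2 * d) := by gcongr
          _ = 16 * M := by field_simp; ring)
    have h6 : ‖(fderiv ℂ g ((c : ℂ) • x)).comp ((c : ℂ) • ContinuousLinearMap.id ℂ E)‖
        ≤ ‖fderiv ℂ g ((c : ℂ) • x)‖ := by
      rw [ContinuousLinearMap.comp_smul, ContinuousLinearMap.comp_id, norm_smul,
        Complex.norm_real, Real.norm_eq_abs, abs_of_nonneg hc0]
      exact mul_le_of_le_one_left (norm_nonneg _) hc1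
    have hih := ih ((c : ℂ) • x) (by rw [hcn]; rw [pow_succ] at hx; linarith)
    rw [hcn] at hih
    have h7 : ‖fderiv ℂ g x‖ ≤ ‖fderiv ℂ g ((c : ℂ) • x)‖ + 2 * (16 * M) / (d / 2) := by
      have := norm_sub_norm_le (fderiv ℂ g x)
        ((fderiv ℂ g ((c : ℂ) • x)).comp ((c : ℂ) • ContinuousLinearMap.id ℂ E))
      linarith
    have h8 : d * (2 * (16 * M) / (d / 2)) = 64 * M := by field_simp; ring
    calc d * ‖fderiv ℂ g x‖
        ≤ d * (‖fderiv ℂ g ((c : ℂ) • x)‖ + 2 * (16 * M) / (d / 2)) := by gcongr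
      _ = d * ‖fderiv ℂ g ((c : ℂ) • x)‖ + 64 * M := by rw [mul_add, h8]
      _ ≤ 128 * M := by linarith

/-- A bound of order `(1 - ‖z‖²)⁻¹` on the radial derivative implies one on the derivative. -/
lemma norm_fderiv_le_of_radial (hg : DifferentiableOn ℂ g (ball 0 1))
    (hM : ∀ z ∈ ball (0 : E) 1, (1 - ‖z‖ ^ 2) * ‖fderiv ℂ g z z‖ ≤ M) {x : E}
    (hx : x ∈ ball (0 : E) 1) : (1 - ‖x‖ ^ 2) * ‖fderiv ℂ g x‖ ≤ 256 * M := by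
  rw [mem_ball_zero_iff] at hx
  obtain ⟨n, hn⟩ := exists_pow_lt_of_lt_one (sub_pos.mpr hx) (by norm_num : (1 / 2 : ℝ) < 1)
  have h := norm_fderiv_le_of_radial_aux hg hM n x hn.le
  have h1 : 1 - ‖x‖ ^ 2 ≤ 2 * (1 - ‖x‖) := by nlinarith [norm_nonneg x]
  calc (1 - ‖x‖ ^ 2) * ‖fderiv ℂ g x‖ ≤ 2 * (1 - ‖x‖) * ‖fderiv ℂ g x‖ := by gcongr
    _ ≤ 256 * M := by linarith

end RadialGrowth

/-! ### Derivative estimates in the Bloch norm, and completeness -/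

section BlochSpaceFacts

variable {E : Type*} [NormedAddCommGroup E] [InnerProductSpace ℂ E]

lemma BlochSpace.sub_apply (f g : BlochSpace E) (x : E) : (f - g) x = f x - g x := rfl

lemma BlochSpace.differentiableAt (f : BlochSpace E) {x : E} (hx : x ∈ ball (0 : E) 1) :
    DifferentiableAt ℂ f x :=
  f.differentiableOn.differentiableAt (isOpen_ball.mem_nhds hx)

lemma BlochSpace.fderiv_sub (f g : BlochSpace E) {x : E} (hx : x ∈ ball (0 : E) 1) :
    fderiv ℂ (f - g : BlochSpace E) x = fderiv ℂ f x - fderiv ℂ g x :=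
  ((f.differentiableAt hx).hasFDerivAt.sub (g.differentiableAt hx).hasFDerivAt).fderiv

lemma BlochSpace.norm_apply_zero_le (f : BlochSpace E) : ‖f 0‖ ≤ ‖f‖ := by
  linarith [BlochSpace.norm_def f, invSeminorm_nonneg f]

lemma BlochSpace.invSeminorm_le_norm (f : BlochSpace E) : invSeminorm f ≤ ‖f‖ := by
  linarith [BlochSpace.norm_def f, norm_nonneg (f 0)]

/-- The derivative of a Bloch function in terms of the radial and tangential parts of the
direction. -/
lemma BlochSpace.norm_fderiv_apply_le (f : BlochSpace E) {x : E} (hx : x ∈ ball (0 : E) 1)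
    (u : E) : ‖fderiv ℂ f x u‖ ≤
      ‖f‖ * (‖lineProj x u‖ / (1 - ‖x‖ ^ 2) + ‖u - lineProj x u‖ / √(1 - ‖x‖ ^ 2)) := by
  have hs := one_sub_sq_pos hx
  have hr := Real.sqrt_pos.mpr hs
  have hs1 : ((1 - ‖x‖ ^ 2 : ℝ) : ℂ) ≠ 0 := by exact_mod_cast hs.ne'
  have hs2 : ((√(1 - ‖x‖ ^ 2) : ℝ) : ℂ) ≠ 0 := by exact_mod_cast hr.ne'
  -- The preimage of u under φ_x'(0), so that f'(x)u = (f ∘ φ_x)'(0)v and only ‖v‖ has to be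
  -- estimated.
  set v : E := -(((1 - ‖x‖ ^ 2 : ℝ) : ℂ)⁻¹ • lineProj x u)
      - ((√(1 - ‖x‖ ^ 2) : ℝ) : ℂ)⁻¹ • (u - lineProj x u) with hv
  have hPv : lineProj x v = -(((1 - ‖x‖ ^ 2 : ℝ) : ℂ)⁻¹ • lineProj x u) := by
    rw [hv, map_sub, map_neg, map_smul, map_smul, map_sub, lineProj_lineProj, sub_self,
      smul_zero, sub_zero]
  have h3 : fderiv ℂ (mobius x) 0 v = u := by
    rw [fderiv_mobius_apply, hPv, hv, sub_sub_cancel_left, smul_neg, smul_neg, neg_neg,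
      sub_neg_eq_add, smul_inv_smul₀ hs1, smul_inv_smul₀ hs2]
    abel
  have h2 := fderiv_comp_mobius f.differentiableOn hx v
  rw [h3] at h2
  have h4 : ‖v‖ ≤ ‖lineProj x u‖ / (1 - ‖x‖ ^ 2) + ‖u - lineProj x u‖ / √(1 - ‖x‖ ^ 2) := by
    refine (norm_sub_le _ _).trans (le_of_eq ?_)
    rw [norm_neg, norm_smul, norm_smul, norm_inv, norm_inv, Complex.norm_real, Complex.norm_real,
      Real.norm_of_nonneg hs.le, Real.norm_of_nonneg hr.le]
    ring
  rw [← h2]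
  refine (ContinuousLinearMap.le_opNorm _ _).trans ?_
  gcongr
  exact (invGradNorm_le_invSeminorm f hx).trans f.invSeminorm_le_norm

lemma BlochSpace.norm_fderiv_le (f : BlochSpace E) {x : E} (hx : x ∈ ball (0 : E) 1) :
    (1 - ‖x‖ ^ 2) * ‖fderiv ℂ f x‖ ≤ 3 * ‖f‖ := by
  have hs := one_sub_sq_pos hx
  have hr := Real.sqrt_pos.mpr hs
  have hsr : 1 - ‖x‖ ^ 2 ≤ √(1 - ‖x‖ ^ 2) :=
    Real.le_sqrt_of_sq_le (by nlinarith [sq_nonneg ‖x‖])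
  rw [mul_comm, ← le_div_iff₀ hs]
  refine ContinuousLinearMap.opNorm_le_bound _ (by positivity) fun u => ?_
  refine (f.norm_fderiv_apply_le hx u).trans ?_
  have h1 := norm_lineProj_le x u
  have h2 : ‖u - lineProj x u‖ ≤ 2 * ‖u‖ := by linarith [norm_sub_le u (lineProj x u)]
  calc ‖f‖ * (‖lineProj x u‖ / (1 - ‖x‖ ^ 2) + ‖u - lineProj x u‖ / √(1 - ‖x‖ ^ 2))
      ≤ ‖f‖ * (‖u‖ / (1 - ‖x‖ ^ 2) + 2 * ‖u‖ / (1 - ‖x‖ ^ 2)) := by gcongr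
    _ = 3 * ‖f‖ / (1 - ‖x‖ ^ 2) * ‖u‖ := by ring

lemma BlochSpace.norm_fderiv_le_of_norm_le (f : BlochSpace E) {x : E} {r : ℝ} (hr : r < 1)
    (hx : ‖x‖ ≤ r) : ‖fderiv ℂ f x‖ ≤ 3 / (1 - r) * ‖f‖ := by
  have h := f.norm_fderiv_le (x := x) (by rw [mem_ball_zero_iff]; linarith)
  have h1 : 1 - r ≤ 1 - ‖x‖ ^ 2 := by nlinarith [norm_nonneg x]
  rw [div_mul_eq_mul_div, le_div_iff₀ (by linarith)]
  nlinarith [norm_nonneg (fderiv ℂ f x)]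

lemma BlochSpace.norm_apply_le (f : BlochSpace E) {x : E} (hx : x ∈ ball (0 : E) 1) :
    ‖f x‖ ≤ (1 + 3 / (1 - ‖x‖)) * ‖f‖ := by
  rw [mem_ball_zero_iff] at hx
  have h := (convex_closedBall (0 : E) ‖x‖).norm_image_sub_le_of_norm_fderiv_le (𝕜 := ℂ)
    (fun y hy => f.differentiableAt
      (by rw [mem_closedBall_zero_iff] at hy; rw [mem_ball_zero_iff]; linarith))
    (fun y hy => f.norm_fderiv_le_of_norm_le hx (by simpa using hy))
    (by simp : (0 : E) ∈ closedBall (0 : E) ‖x‖) (by simp : x ∈ closedBall (0 : E) ‖x‖)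
  have h0 := f.norm_apply_zero_le
  have hp : 0 ≤ 3 / (1 - ‖x‖) * ‖f‖ :=
    mul_nonneg (div_nonneg (by norm_num) (by linarith)) (norm_nonneg _)
  rw [sub_zero] at h
  have h1 : 3 / (1 - ‖x‖) * ‖f‖ * ‖x‖ ≤ 3 / (1 - ‖x‖) * ‖f‖ :=
    mul_le_of_le_one_right hp hx.le
  linarith [norm_sub_norm_le (f x) (f 0)]

/-- The derivatives of Bloch functions are Lipschitz on smaller balls. -/
lemma BlochSpace.norm_fderiv_sub_le (f : BlochSpace E) {δ : ℝ} (hδ : δ < 1) {x y : E}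
    (hx : ‖x‖ ≤ δ) (hy : ‖y‖ ≤ δ) :
    ‖fderiv ℂ f x - fderiv ℂ f y‖ ≤ 24 / (1 - δ) ^ 2 * ‖f‖ * ‖x - y‖ := by
  -- Cauchy's estimate on `ball x r` is applied to the difference of f and its translate by y - x.
  -- Both arguments stay within norm 1 - r, where ‖f'‖ ≤ (3/r)‖f‖. The factor 2/r from Cauchy gives
  -- 6/r² = 24/(1 - δ)².
  set r : ℝ := (1 - δ) / 2 with hr
  have hr0 : 0 < r := by rw [hr]; linarith
  have hball : ∀ w : E, ‖w‖ ≤ δ → ∀ z ∈ ball x r, ‖z + (w - x)‖ ≤ 1 - r := by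
    intro w hw z hz
    rw [mem_ball, dist_eq_norm] at hz
    have : z + (w - x) = w + (z - x) := by abel
    rw [this]
    linarith [norm_add_le w (z - x)]
  have hdiff : ∀ w : E, ‖w‖ ≤ δ → ∀ z ∈ ball x r, DifferentiableAt ℂ f (z + (w - x)) :=
    fun w hw z hz => f.differentiableAt (by rw [mem_ball_zero_iff]; linarith [hball w hw z hz])
  have hder : ∀ w : E, ‖w‖ ≤ δ → ∀ z ∈ ball x r,
      HasFDerivAt (fun z => f (z + (w - x))) (fderiv ℂ f (z + (w - x))) z := fun w hw z hz =>
    (hasFDerivAt_comp_add_right _).mpr (hdiff w hw z hz).hasFDerivAt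
  have hxr := mem_ball_self (x := x) hr0
  have h1 := ((hder x hx x hxr).sub (hder y hy x hxr))
  simp only [sub_self, add_zero, add_sub_cancel] at h1
  have h := norm_le_of_hasFDerivAt (C := 3 / (1 - (1 - r)) * ‖f‖ * ‖x - y‖) hr0
    (fun z hz => by
      have := ((hder x hx z hz).sub (hder y hy z hz)).differentiableAt.differentiableWithinAt
        (s := ball x r)
      simpa only [sub_self, add_zero] using this) h1
    (fun z hz => by
      have h2 := (convex_closedBall (0 : E) (1 - r)).norm_image_sub_le_of_norm_fderiv_le (𝕜 := ℂ)
        (fun p hp => f.differentiableAt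
          (by rw [mem_closedBall_zero_iff] at hp; rw [mem_ball_zero_iff]; linarith))
        (fun p hp => f.norm_fderiv_le_of_norm_le (r := 1 - r) (by linarith) (by simpa using hp))
        (mem_closedBall_zero_iff.mpr (hball y hy z hz))
        (mem_closedBall_zero_iff.mpr (hball x hx z hz))
      simpa using h2)
  refine h.trans (le_of_eq ?_)
  have : 1 - δ = 2 * r := by rw [hr]; ring
  rw [this, sub_sub_cancel]
  field_simp
  ring

lemma BlochSpace.norm_le (f : BlochSpace E) {M : ℝ}
    (hM : ∀ x ∈ ball (0 : E) 1, (1 - ‖x‖ ^ 2) * ‖fderiv ℂ f x‖ ≤ M) :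
    ‖f‖ ≤ ‖f 0‖ + 21 * M := by
  have : Nonempty (ball (0 : E) 1) := ⟨⟨0, by simp⟩⟩
  rw [BlochSpace.norm_def]
  gcongr
  exact ciSup_le fun x => invGradNorm_le f.differentiableOn hM x.2

/-- A holomorphic function on the ball whose derivative has the required growth defines an element
of the Bloch space. -/
lemma BlochSpace.exists_of_hasFDerivAt {f : E → ℂ} {D : E → E →L[ℂ] ℂ} {M : ℝ}
    (hf : ∀ x ∈ ball (0 : E) 1, HasFDerivAt f (D x) x)
    (hM : ∀ x ∈ ball (0 : E) 1, (1 - ‖x‖ ^ 2) * ‖D x‖ ≤ M) :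
    ∃ F : BlochSpace E, ‖F‖ ≤ ‖f 0‖ + 21 * M ∧ (∀ x ∈ ball (0 : E) 1, F x = f x) ∧
      ∀ x ∈ ball (0 : E) 1, fderiv ℂ F x = D x := by
  have hder : ∀ x ∈ ball (0 : E) 1, HasFDerivAt ((ball (0 : E) 1).indicator f) (D x) x :=
    fun x hx => (hf x hx).congr_of_eventuallyEq <|
      Filter.mem_of_superset (isOpen_ball.mem_nhds hx) fun y hy => Set.indicator_of_mem hy _
  let F : BlochSpace E := Subtype.mk ((ball (0 : E) 1).indicator f)
    ⟨fun x hx => (hder x hx).differentiableAt.differentiableWithinAt,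
      fun x hx => Set.indicator_of_notMem hx _, M, fun x hx => by
        rw [(hder x hx).fderiv]
        exact hM x hx⟩
  have hF : ∀ x ∈ ball (0 : E) 1, F x = f x := fun x hx => Set.indicator_of_mem hx f
  have hFD : ∀ x ∈ ball (0 : E) 1, fderiv ℂ F x = D x := fun x hx => (hder x hx).fderiv
  refine ⟨F, ?_, hF, hFD⟩
  rw [← hF 0 (by simp)]
  exact F.norm_le fun x hx => by
    rw [hFD x hx]
    exact hM x hx

/-- The norm of the Bloch space is controlled by the radial derivative. -/
lemma BlochSpace.norm_le_of_radial (f : BlochSpace E) {M : ℝ}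
    (hM : ∀ z ∈ ball (0 : E) 1, (1 - ‖z‖ ^ 2) * ‖fderiv ℂ f z z‖ ≤ M) :
    ‖f‖ ≤ ‖f 0‖ + 5376 * M := by
  have := f.norm_le fun x hx => norm_fderiv_le_of_radial f.differentiableOn hM hx
  linarith

/-- Completeness turns total boundedness of the image of the unit ball into relative compactness. A
Cauchy sequence converges pointwise, and its derivatives converge uniformly on smaller balls, so the
limit is holomorphic. Norm convergence follows from the weighted derivative bound. -/
instance : CompleteSpace (BlochSpace E) := by
  refine Metric.complete_of_cauchySeq_tendsto fun u hu => ?_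
  have hcauchy : ∀ ε > 0, ∃ N, ∀ m ≥ N, ∀ n ≥ N, ‖u m - u n‖ < ε := fun ε hε => by
    simpa only [dist_eq_norm] using Metric.cauchySeq_iff.mp hu ε hε
  -- The membership hypothesis sits inside the existential so that `choose` gives a total function;
  -- its values off the ball are irrelevant.
  have hlim : ∀ x : E, ∃ y : ℂ, x ∈ ball (0 : E) 1 → Tendsto (fun n => u n x) atTop (𝓝 y) := by
    intro x
    by_cases hx : x ∈ ball (0 : E) 1
    · have h1 : 0 < 1 + 3 / (1 - ‖x‖) := by
        have : 0 < 1 - ‖x‖ := by simpa using hx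
        positivity
      obtain ⟨y, hy⟩ := cauchySeq_tendsto_of_complete (u := fun n => u n x)
        (Metric.cauchySeq_iff.mpr fun ε hε => by
          obtain ⟨N, hN⟩ := hcauchy (ε / (1 + 3 / (1 - ‖x‖))) (by positivity)
          refine ⟨N, fun m hm n hn => ?_⟩
          rw [dist_eq_norm, ← BlochSpace.sub_apply]
          calc _ ≤ (1 + 3 / (1 - ‖x‖)) * ‖u m - u n‖ := BlochSpace.norm_apply_le _ hx
            _ < (1 + 3 / (1 - ‖x‖)) * (ε / (1 + 3 / (1 - ‖x‖))) := by gcongr; exact hN m hm n hn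
            _ = ε := by field_simp)
      exact ⟨y, fun _ => hy⟩
    · exact ⟨0, fun h => absurd h hx⟩
  choose G hG using hlim
  have hdcauchy : ∀ r < 1, ∀ ε > 0, ∃ N, ∀ m ≥ N, ∀ n ≥ N, ∀ x : E, ‖x‖ ≤ r →
      ‖fderiv ℂ (u m) x - fderiv ℂ (u n) x‖ < ε := by
    intro r hr ε hε
    have h1 : 0 < 3 / (1 - r) := div_pos (by norm_num) (by linarith)
    obtain ⟨N, hN⟩ := hcauchy (ε / (3 / (1 - r))) (by positivity)
    refine ⟨N, fun m hm n hn x hx => ?_⟩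
    rw [← BlochSpace.fderiv_sub _ _ (by rw [mem_ball_zero_iff]; linarith)]
    calc _ ≤ 3 / (1 - r) * ‖u m - u n‖ := BlochSpace.norm_fderiv_le_of_norm_le _ hr hx
      _ < 3 / (1 - r) * (ε / (3 / (1 - r))) := by gcongr; exact hN m hm n hn
      _ = ε := mul_div_cancel₀ _ h1.ne'
  have hdlim : ∀ x : E, ∃ y : E →L[ℂ] ℂ, x ∈ ball (0 : E) 1 →
      Tendsto (fun n => fderiv ℂ (u n) x) atTop (𝓝 y) := by
    intro x
    by_cases hx : x ∈ ball (0 : E) 1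
    · obtain ⟨y, hy⟩ := cauchySeq_tendsto_of_complete (u := fun n => fderiv ℂ (u n) x)
        (Metric.cauchySeq_iff.mpr fun ε hε => by
          obtain ⟨N, hN⟩ := hdcauchy ‖x‖ (by simpa using hx) ε hε
          exact ⟨N, fun m hm n hn => by rw [dist_eq_norm]; exact hN m hm n hn x le_rfl⟩)
      exact ⟨y, fun _ => hy⟩
    · exact ⟨0, fun h => absurd h hx⟩
  choose D hD using hdlim
  have hGD : ∀ x ∈ ball (0 : E) 1, HasFDerivAt G (D x) x := by
    intro x hx
    rw [mem_ball_zero_iff] at hx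
    obtain ⟨r, hxr, hr⟩ := exists_between hx
    have hsub : ∀ y ∈ ball (0 : E) r, y ∈ ball (0 : E) 1 := fun y hy =>
      ball_subset_ball hr.le hy
    refine hasFDerivAt_of_tendstoUniformlyOn (l := atTop) (f := fun n => u n)
      (f' := fun n => fderiv ℂ (u n)) (s := ball (0 : E) r) isOpen_ball ?_
      (fun n y hy => ((u n).differentiableAt (hsub y hy)).hasFDerivAt)
      (fun y hy => hG y (hsub y hy)) (by simpa using hxr)
    refine UniformCauchySeqOn.tendstoUniformlyOn_of_tendsto
      (Metric.uniformCauchySeqOn_iff.mpr fun ε hε => ?_) fun y hy => hD y (hsub y hy)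
    obtain ⟨N, hN⟩ := hdcauchy r hr ε hε
    refine ⟨N, fun m hm n hn y hy => ?_⟩
    rw [dist_eq_norm]
    exact hN m hm n hn y (by rw [mem_ball_zero_iff] at hy; exact hy.le)
  -- Letting m → ∞ in the Cauchy condition keeps the estimate uniform over the whole ball, not just
  -- over smaller balls.
  have hnear : ∀ ε > 0, ∃ N, ∀ n ≥ N, ∀ x ∈ ball (0 : E) 1,
      (1 - ‖x‖ ^ 2) * ‖fderiv ℂ (u n) x - D x‖ ≤ 3 * ε := by
    intro ε hε
    obtain ⟨N, hN⟩ := hcauchy ε hε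
    refine ⟨N, fun n hn x hx => ?_⟩
    refine le_of_tendsto ((tendsto_const_nhds.sub (hD x hx)).norm.const_mul (1 - ‖x‖ ^ 2))
      (eventually_atTop.mpr ⟨N, fun m hm => ?_⟩)
    rw [← BlochSpace.fderiv_sub _ _ hx]
    refine (BlochSpace.norm_fderiv_le _ hx).trans ?_
    linarith [hN n hn m hm]
  obtain ⟨N₁, hN₁⟩ := hnear 1 one_pos
  obtain ⟨F, -, hFG, hFD⟩ := BlochSpace.exists_of_hasFDerivAt (M := 3 * ‖u N₁‖ + 3 * 1) hGD
    fun x hx => by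
      have h1 := hN₁ N₁ le_rfl x hx
      have h2 := (u N₁).norm_fderiv_le hx
      have h3 := norm_sub_norm_le (D x) (fderiv ℂ (u N₁) x)
      rw [norm_sub_rev] at h3
      nlinarith [one_sub_sq_pos hx]
  have h0 : (0 : E) ∈ ball (0 : E) 1 := by simp
  refine ⟨F, Metric.tendsto_atTop.mpr fun ε hε => ?_⟩
  obtain ⟨N₂, hN₂⟩ := hnear (ε / 200) (by positivity)
  obtain ⟨N₃, hN₃⟩ := Metric.tendsto_atTop.mp (hG 0 h0) (ε / 2) (by positivity)
  refine ⟨max N₂ N₃, fun n hn => ?_⟩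
  rw [dist_eq_norm]
  have h1 := (u n - F).norm_le (M := 3 * (ε / 200)) fun x hx => by
    rw [BlochSpace.fderiv_sub _ _ hx, hFD x hx]
    exact hN₂ n (le_of_max_le_left hn) x hx
  have h2 := hN₃ n (le_of_max_le_right hn)
  rw [dist_eq_norm] at h2
  rw [BlochSpace.sub_apply, hFG 0 h0] at h1
  linarith

end BlochSpaceFacts

/-! ### Sufficiency: total boundedness of the image of the unit ball -/

/-- A map is totally bounded on a set on which it is uniformly controlled by maps with bounded
image in a proper space. -/
lemma totallyBounded_image_of_controlled {X Y : Type*} [PseudoMetricSpace Y] {T : X → Y}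
    {A : Set X} (h : ∀ ε > 0, ∃ (n : Type) (_ : Fintype n) (Φ : X → n → ℂ),
      Bornology.IsBounded (Φ '' A) ∧
        ∃ η > 0, ∀ f ∈ A, ∀ g ∈ A, dist (Φ f) (Φ g) < η → dist (T f) (T g) < ε) :
    TotallyBounded (T '' A) := by
  refine Metric.totallyBounded_iff.mpr fun ε hε => ?_
  obtain ⟨n, _, Φ, hb, η, hη, hΦ⟩ := h ε hε
  have htb : TotallyBounded (Φ '' A) := hb.isCompact_closure.totallyBounded.subset subset_closure
  obtain ⟨t, htA, htf, hcov⟩ := Set.exists_subset_image_finite_and.mp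
    (Metric.finite_approx_of_totallyBounded htb η hη)
  refine ⟨T '' t, htf.image _, ?_⟩
  rintro _ ⟨f, hf, rfl⟩
  obtain ⟨y, hy, hfy⟩ := Set.mem_iUnion₂.mp (hcov (Set.mem_image_of_mem Φ hf))
  obtain ⟨g, hg, rfl⟩ := hy
  exact Set.mem_iUnion₂.mpr ⟨T g, Set.mem_image_of_mem T hg, hΦ f hf g (htA hg) hfy⟩

section Composition

variable {E : Type*} [NormedAddCommGroup E] [InnerProductSpace ℂ E] {φ : E → E}
  {hφ : DifferentiableOn ℂ φ (ball 0 1)} {hmaps : Set.MapsTo φ (ball 0 1) (ball 0 1)}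

lemma fderiv_compositionOperator_self (f : BlochSpace E) {z : E} (hz : z ∈ ball (0 : E) 1) :
    fderiv ℂ (compositionOperator φ hφ hmaps f) z z = fderiv ℂ f (φ z) (radialDeriv φ z) := by
  have heq : (compositionOperator φ hφ hmaps f).toFun =ᶠ[𝓝 z] fun y => f (φ y) :=
    Filter.mem_of_superset (isOpen_ball.mem_nhds hz) fun y hy =>
      compositionOperator_apply φ hφ hmaps f hy
  rw [heq.fderiv_eq]
  have h : HasFDerivAt (fun y => f (φ y)) _ z :=
    (f.differentiableAt (hmaps hz)).hasFDerivAt.comp z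
      (hφ.differentiableAt (isOpen_ball.mem_nhds hz)).hasFDerivAt
  rw [h.fderiv]
  rfl

/-- By the chain rule only Rφ enters the radial derivative of f ∘ φ, and
`BlochSpace.norm_le_of_radial` recovers the norm from it. The weight is kept inside the direction
because the compactness hypothesis concerns the vectors (1 - ‖z‖²)Rφ(z). -/
lemma norm_compositionOperator_le (f : BlochSpace E) {M : ℝ}
    (hM : ∀ z ∈ ball (0 : E) 1,
      ‖fderiv ℂ f (φ z) ((1 - ‖z‖ ^ 2) • radialDeriv φ z)‖ ≤ M) :
    ‖compositionOperator φ hφ hmaps f‖ ≤ ‖f (φ 0)‖ + 5376 * M := by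
  rw [← compositionOperator_apply φ hφ hmaps f (by simp)]
  refine BlochSpace.norm_le_of_radial _ fun z hz => ?_
  have h := hM z hz
  rw [← Complex.coe_smul, map_smul, norm_smul, Complex.norm_real,
    Real.norm_of_nonneg (one_sub_sq_pos hz).le] at h
  rwa [fderiv_compositionOperator_self f hz]

/-- The projection has norm |⟨u, a⟩|/‖a‖. This lets limit (ii), stated with the unnormalised inner
product, control the radial part. -/
lemma norm_lineProj_le_of_half_le {a u : E} (ha : 1 / 2 ≤ ‖a‖) :
    ‖lineProj a u‖ ≤ 2 * ‖(inner ℂ a u : ℂ)‖ := by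
  rw [lineProj_apply, norm_smul, norm_mul, norm_inv, Complex.norm_real,
    Real.norm_of_nonneg (by positivity)]
  have h0 : 0 < ‖a‖ := by linarith
  have h1 : (‖a‖ ^ 2)⁻¹ * ‖(inner ℂ a u : ℂ)‖ * ‖a‖ = ‖(inner ℂ a u : ℂ)‖ / ‖a‖ := by field_simp
  rw [h1, div_le_iff₀ h0]
  nlinarith [norm_nonneg (inner ℂ a u : ℂ)]

/-- Near the boundary, the radial derivative of `f ∘ φ` is controlled by the two limits. -/
lemma exists_norm_fderiv_radial_le
    (h1 : TendstoZeroAtBoundary φ fun z =>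
      (1 - ‖z‖ ^ 2) * ‖radialDeriv φ z‖ / √(1 - ‖φ z‖ ^ 2))
    (h2 : TendstoZeroAtBoundary φ fun z =>
      (1 - ‖z‖ ^ 2) * ‖(inner ℂ (φ z) (radialDeriv φ z) : ℂ)‖ / (1 - ‖φ z‖ ^ 2))
    (hmaps : Set.MapsTo φ (ball 0 1) (ball 0 1)) {ε : ℝ} (hε : 0 < ε) :
    ∃ δ, 0 < δ ∧ δ < 1 ∧ ∀ z ∈ ball (0 : E) 1, δ < ‖φ z‖ → ∀ f : BlochSpace E,
      ‖fderiv ℂ f (φ z) ((1 - ‖z‖ ^ 2) • radialDeriv φ z)‖ ≤ ε * ‖f‖ := by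
  obtain ⟨δ₁, hδ₁, H1⟩ := h1 (ε / 4) (by positivity)
  obtain ⟨δ₂, hδ₂, H2⟩ := h2 (ε / 4) (by positivity)
  refine ⟨max (max δ₁ δ₂) (1 / 2), by positivity, max_lt (max_lt hδ₁ hδ₂) (by norm_num),
    fun z hz hzδ f => ?_⟩
  have hz1 : δ₁ < ‖φ z‖ := ((le_max_left _ _).trans (le_max_left _ _)).trans_lt hzδ
  have hz2 : δ₂ < ‖φ z‖ := ((le_max_right _ _).trans (le_max_left _ _)).trans_lt hzδ
  have hz3 : 1 / 2 < ‖φ z‖ := (le_max_right _ _).trans_lt hzδ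
  have hd := one_sub_sq_pos hz
  have hs := one_sub_sq_pos (hmaps hz)
  have hr := Real.sqrt_pos.mpr hs
  have H1' := (abs_lt.mp (H1 z hz hz1)).2
  have H2' := (abs_lt.mp (H2 z hz hz2)).2
  set u := radialDeriv φ z with hu
  rw [← Complex.coe_smul, map_smul, norm_smul, Complex.norm_real, Real.norm_of_nonneg hd.le]
  have h3 := norm_lineProj_le_of_half_le (u := u) hz3.le
  have h4 : ‖u - lineProj (φ z) u‖ ≤ 2 * ‖u‖ := by
    linarith [norm_sub_le u (lineProj (φ z) u), norm_lineProj_le (φ z) u]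
  calc (1 - ‖z‖ ^ 2) * ‖fderiv ℂ f (φ z) u‖
      ≤ (1 - ‖z‖ ^ 2) * (‖f‖ * (‖lineProj (φ z) u‖ / (1 - ‖φ z‖ ^ 2)
        + ‖u - lineProj (φ z) u‖ / √(1 - ‖φ z‖ ^ 2))) := by
        gcongr; exact f.norm_fderiv_apply_le (hmaps hz) u
    _ ≤ (1 - ‖z‖ ^ 2) * (‖f‖ * (2 * ‖(inner ℂ (φ z) u : ℂ)‖ / (1 - ‖φ z‖ ^ 2)
        + 2 * ‖u‖ / √(1 - ‖φ z‖ ^ 2))) := by gcongr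
    _ = ‖f‖ * (2 * ((1 - ‖z‖ ^ 2) * ‖(inner ℂ (φ z) u : ℂ)‖ / (1 - ‖φ z‖ ^ 2))
        + 2 * ((1 - ‖z‖ ^ 2) * ‖u‖ / √(1 - ‖φ z‖ ^ 2))) := by ring
    _ ≤ ‖f‖ * (2 * (ε / 4) + 2 * (ε / 4)) := by gcongr
    _ = ε * ‖f‖ := by ring

/-- The directional derivatives `f'(x) y` of Bloch functions depend on `(x, y)` in a Lipschitz
way. -/
lemma BlochSpace.norm_fderiv_apply_sub_le (f : BlochSpace E) {δ B : ℝ} (hδ : δ < 1) {x x' y y' : E}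
    (hx : ‖x‖ ≤ δ) (hx' : ‖x'‖ ≤ δ) (hy : ‖y‖ ≤ B) :
    ‖fderiv ℂ f x y - fderiv ℂ f x' y'‖ ≤
      (24 / (1 - δ) ^ 2 * B * ‖x - x'‖ + 3 / (1 - δ) * ‖y - y'‖) * ‖f‖ := by
  have h1 : fderiv ℂ f x y - fderiv ℂ f x' y'
      = (fderiv ℂ f x - fderiv ℂ f x') y + fderiv ℂ f x' (y - y') := by simp
  have h0 : 0 < 1 - δ := by linarith
  rw [h1]
  calc _ ≤ ‖fderiv ℂ f x - fderiv ℂ f x'‖ * ‖y‖ + ‖fderiv ℂ f x'‖ * ‖y - y'‖ :=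
        (norm_add_le _ _).trans (add_le_add (ContinuousLinearMap.le_opNorm _ _)
          (ContinuousLinearMap.le_opNorm _ _))
    _ ≤ 24 / (1 - δ) ^ 2 * ‖f‖ * ‖x - x'‖ * B + 3 / (1 - δ) * ‖f‖ * ‖y - y'‖ := by
        gcongr
        · exact f.norm_fderiv_sub_le hδ hx hx'
        · exact f.norm_fderiv_le_of_norm_le hδ hx'
    _ = _ := by ring

/-- The ball is split at ‖φ z‖ = δ. Outside, the limits make every f in the unit ball contribute
little; inside, a finite net of pairs (φ z, (1 - ‖z‖²)Rφ(z)) reduces the supremum to finitely many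
functionals of f. -/
theorem isCompactOperator_compositionOperator
    (hφ_compact : ∀ δ : ℝ, 0 < δ → δ < 1 →
      IsCompact (closure (φ '' {z ∈ ball (0 : E) 1 | ‖φ z‖ ≤ δ})))
    (hR_compact : ∀ δ : ℝ, 0 < δ → δ < 1 →
      IsCompact (closure ((fun z => (1 - ‖z‖ ^ 2) • radialDeriv φ z) ''
        {z ∈ ball (0 : E) 1 | ‖φ z‖ ≤ δ})))
    (h1 : TendstoZeroAtBoundary φ fun z =>
      (1 - ‖z‖ ^ 2) * ‖radialDeriv φ z‖ / √(1 - ‖φ z‖ ^ 2))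
    (h2 : TendstoZeroAtBoundary φ fun z =>
      (1 - ‖z‖ ^ 2) * ‖(inner ℂ (φ z) (radialDeriv φ z) : ℂ)‖ / (1 - ‖φ z‖ ^ 2)) :
    IsCompactOperator (compositionOperator φ hφ hmaps) := by
  rw [isCompactOperator_iff_isCompact_closure_image_closedBall
    (compositionOperator φ hφ hmaps) one_pos]
  refine TotallyBounded.isCompact_of_isClosed (TotallyBounded.closure <| totallyBounded_image_of_controlled fun ε hε => ?_) isClosed_closure
  -- The final bound is η + 5376 · 3η = 16129 η < ε.
  set η : ℝ := ε / 30000 with hη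
  have hη0 : 0 < η := by positivity
  obtain ⟨δ, hδ0, hδ1, hbdry⟩ := exists_norm_fderiv_radial_le h1 h2 hmaps hη0
  set S : Set E := {z ∈ ball (0 : E) 1 | ‖φ z‖ ≤ δ} with hS
  set R : E → E := fun z => (1 - ‖z‖ ^ 2) • radialDeriv φ z with hR
  obtain ⟨B, hB0, hB⟩ := ((hR_compact δ hδ0 hδ1).isBounded.subset subset_closure).exists_pos_norm_le
  have hδ' : 0 < 1 - δ := by linarith
  -- Lipschitz constant of (x, y) ↦ f'(x)y per unit of ‖f‖; a net of mesh η/L then costs at most 2η,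
  -- as ‖f - g‖ ≤ 2.
  set L : ℝ := 24 / (1 - δ) ^ 2 * B + 3 / (1 - δ) with hL
  have hL0 : 0 < L := by positivity
  have htb : TotallyBounded ((fun z => (φ z, R z)) '' S) := by
    refine (((hφ_compact δ hδ0 hδ1).prod (hR_compact δ hδ0 hδ1)).totallyBounded).subset ?_
    rintro _ ⟨z, hz, rfl⟩
    exact ⟨subset_closure (Set.mem_image_of_mem φ hz), subset_closure (Set.mem_image_of_mem R hz)⟩
  obtain ⟨t, htS, htf, hcov⟩ := Set.exists_subset_image_finite_and.mp
    (Metric.finite_approx_of_totallyBounded htb (η / L) (by positivity))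
  obtain ⟨N, p, -, rfl⟩ := htf.fin_param
  have hpS : ∀ i, p i ∈ S := fun i => htS (Set.mem_range_self i)
  have hφ0 : φ 0 ∈ ball (0 : E) 1 := hmaps (by simp)
  -- The coordinate `none` records f(φ 0), the value of f ∘ φ at the origin; `some i` records the
  -- weighted radial derivative at the net point `p i`.
  refine ⟨Option (Fin N), inferInstance,
    fun f o => o.elim (f (φ 0)) fun i => fderiv ℂ f (φ (p i)) (R (p i)), ?_, η, hη0, ?_⟩
  · have h3 : 0 < 1 - ‖φ 0‖ := by simpa using hφ0
    refine isBounded_iff_forall_norm_le.mpr ⟨1 + 3 / (1 - ‖φ 0‖) + 3 / (1 - δ) * B, ?_⟩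
    rintro _ ⟨f, hf, rfl⟩
    rw [mem_closedBall_zero_iff] at hf
    refine (pi_norm_le_iff_of_nonneg (by positivity)).mpr fun o => ?_
    cases o with
    | none =>
      have h4 : (1 + 3 / (1 - ‖φ 0‖)) * ‖f‖ ≤ 1 + 3 / (1 - ‖φ 0‖) :=
        mul_le_of_le_one_right (by positivity) hf
      have h5 : 0 ≤ 3 / (1 - δ) * B := by positivity
      exact (f.norm_apply_le hφ0).trans (by linarith)
    | some i =>
      have h4 : ‖fderiv ℂ f (φ (p i))‖ ≤ 3 / (1 - δ) :=
        (f.norm_fderiv_le_of_norm_le hδ1 (hpS i).2).trans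
          (mul_le_of_le_one_right (by positivity) hf)
      have h5 : 0 ≤ 3 / (1 - ‖φ 0‖) := by positivity
      calc ‖fderiv ℂ f (φ (p i)) (R (p i))‖ ≤ ‖fderiv ℂ f (φ (p i))‖ * ‖R (p i)‖ :=
            ContinuousLinearMap.le_opNorm _ _
        _ ≤ 3 / (1 - δ) * B := by
            gcongr
            exact hB _ (Set.mem_image_of_mem R (hpS i))
        _ ≤ _ := by linarith
  · intro f hf g hg hfg
    rw [mem_closedBall_zero_iff] at hf hg
    have hh : ‖f - g‖ ≤ 2 := (norm_sub_le f g).trans (by linarith)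
    have hcoord := fun o => (dist_le_pi_dist _ _ o).trans hfg.le
    have h0 : ‖(f - g) (φ 0)‖ ≤ η := by
      simpa [dist_eq_norm, BlochSpace.sub_apply] using hcoord none
    have hi : ∀ i, ‖fderiv ℂ (f - g : BlochSpace E) (φ (p i)) (R (p i))‖ ≤ η := fun i => by
      rw [BlochSpace.fderiv_sub f g (hmaps (hpS i).1)]
      simpa [dist_eq_norm] using hcoord (some i)
    have hmain := norm_compositionOperator_le (hφ := hφ) (hmaps := hmaps) (f - g) (M := 3 * η)
      fun z hz => by
        rcases lt_or_ge δ ‖φ z‖ with h | h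
        · have := hbdry z hz h (f - g)
          nlinarith
        · have hzS : z ∈ S := ⟨hz, h⟩
          obtain ⟨_, ⟨_, ⟨i, rfl⟩, rfl⟩, hzi⟩ :=
            Set.mem_iUnion₂.mp (hcov (Set.mem_image_of_mem _ hzS))
          rw [mem_ball, Prod.dist_eq, max_lt_iff, dist_eq_norm, dist_eq_norm] at hzi
          have h3 := (f - g).norm_fderiv_apply_sub_le (y' := R (p i)) hδ1 h (hpS i).2
            (hB _ (Set.mem_image_of_mem R hzS))
          have h4 : (24 / (1 - δ) ^ 2 * B * ‖φ z - φ (p i)‖ + 3 / (1 - δ) * ‖R z - R (p i)‖)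
              * ‖f - g‖ ≤ 2 * η := by
            calc _ ≤ (24 / (1 - δ) ^ 2 * B * (η / L) + 3 / (1 - δ) * (η / L)) * 2 := by
                  gcongr
                  · exact hzi.1.le
                  · exact hzi.2.le
              _ = L * (η / L) * 2 := by rw [hL]; ring
              _ = 2 * η := by rw [mul_div_cancel₀ _ hL0.ne']; ring
          have h5 := norm_sub_norm_le (fderiv ℂ (f - g : BlochSpace E) (φ z) (R z))
            (fderiv ℂ (f - g : BlochSpace E) (φ (p i)) (R (p i)))
          linarith [hi i]
    rw [dist_eq_norm, ← map_sub]
    linarith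

end Composition

/-! ### Necessity: compactness tested on pointwise null families -/

section Necessity

variable {E : Type*} [NormedAddCommGroup E] [InnerProductSpace ℂ E] {φ : E → E}
  {hφ : DifferentiableOn ℂ φ (ball 0 1)} {hmaps : Set.MapsTo φ (ball 0 1) (ball 0 1)}

/-- A compact composition operator maps bounded pointwise null sequences to null sequences. -/
lemma tendsto_compositionOperator_zero
    (hC : IsCompactOperator (compositionOperator φ hφ hmaps)) {f : ℕ → BlochSpace E} {B : ℝ}
    (hB : ∀ n, ‖f n‖ ≤ B)
    (hf : ∀ x ∈ ball (0 : E) 1, Tendsto (fun n => f n x) atTop (𝓝 0)) :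
    Tendsto (fun n => compositionOperator φ hφ hmaps (f n)) atTop (𝓝 0) := by
  obtain ⟨K, hK, hKs⟩ := hC.image_closedBall_subset_compact
    (f := compositionOperator φ hφ hmaps) B
  -- Every subsequence has a further one whose images converge in norm. Point evaluations are
  -- continuous, so the limit must be the pointwise limit 0.
  refine tendsto_of_subseq_tendsto fun ns hns => ?_
  obtain ⟨a, -, ψ, hψ, ha⟩ := hK.tendsto_subseq
    (x := fun n => compositionOperator φ hφ hmaps (f (ns n)))
    fun n => hKs (Set.mem_image_of_mem _ (by simpa using hB (ns n)))
  refine ⟨ψ, ?_⟩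
  have ha0 : a = 0 := by
    refine BlochSpace.ext_ball fun x hx => ?_
    have hlim : Tendsto (fun n => compositionOperator φ hφ hmaps (f (ns (ψ n))) x) atTop
        (𝓝 (a x)) := by
      refine tendsto_iff_norm_sub_tendsto_zero.mpr (squeeze_zero (fun _ => norm_nonneg _)
        (fun n => (BlochSpace.norm_apply_le
          (compositionOperator φ hφ hmaps (f (ns (ψ n))) - a) hx)) ?_)
      simpa using (tendsto_iff_norm_sub_tendsto_zero.mp ha).const_mul (1 + 3 / (1 - ‖x‖))
    refine tendsto_nhds_unique hlim ?_
    have := (hf (φ x) (hmaps hx)).comp (hns.comp hψ.tendsto_atTop)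
    refine this.congr fun n => ?_
    exact (compositionOperator_apply φ hφ hmaps _ hx).symm
  rwa [ha0] at ha

/-- A uniform form of the previous lemma. A failure for every δ would give a sequence with ‖a_n‖ →
1, and the bound √(1 - ‖a_n‖²)/(1 - ‖x‖) forces its test functions to 0 pointwise while their images
stay of norm at least ε. -/
lemma exists_norm_compositionOperator_lt
    (hC : IsCompactOperator (compositionOperator φ hφ hmaps)) (B : ℝ) {ε : ℝ} (hε : 0 < ε) :
    ∃ δ < 1, ∀ a ∈ ball (0 : E) 1, δ < ‖a‖ → ∀ f : BlochSpace E, ‖f‖ ≤ B →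
      (∀ x ∈ ball (0 : E) 1, ‖f x‖ ≤ √(1 - ‖a‖ ^ 2) / (1 - ‖x‖)) →
        ‖compositionOperator φ hφ hmaps f‖ < ε := by
  by_contra! hcon
  choose a ha1 haδ f hfB hfx hfε using fun n : ℕ =>
    hcon (1 - 1 / ((n : ℝ) + 1)) (by have : 0 < 1 / ((n : ℝ) + 1) := by positivity
                                     linarith)
  have hnorm : Tendsto (fun n => ‖a n‖) atTop (𝓝 1) := by
    refine tendsto_of_tendsto_of_tendsto_of_le_of_le ?_ tendsto_const_nhds
      (fun n => (haδ n).le) fun n => (mem_ball_zero_iff.mp (ha1 n)).le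
    simpa using tendsto_const_nhds.sub (tendsto_one_div_add_atTop_nhds_zero_nat (𝕜 := ℝ))
      (f := fun _ => (1 : ℝ))
  have hlim := tendsto_compositionOperator_zero hC hfB fun x hx => by
    refine squeeze_zero_norm (fun n => hfx n x hx) ?_
    have h1 : Tendsto (fun n => √(1 - ‖a n‖ ^ 2) / (1 - ‖x‖)) atTop
        (𝓝 (√(1 - 1 ^ 2) / (1 - ‖x‖))) :=
      ((tendsto_const_nhds.sub (hnorm.pow 2)).sqrt).div_const _
    simpa using h1
  have h2 := le_of_tendsto_of_tendsto' tendsto_const_nhds hlim.norm hfε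
  rw [norm_zero] at h2
  linarith

lemma norm_fderiv_radial_le_compositionOperator (f : BlochSpace E) {z : E}
    (hz : z ∈ ball (0 : E) 1) :
    (1 - ‖z‖ ^ 2) * ‖fderiv ℂ f (φ z) (radialDeriv φ z)‖ ≤
      3 * ‖compositionOperator φ hφ hmaps f‖ := by
  rw [← fderiv_compositionOperator_self (hφ := hφ) (hmaps := hmaps) f hz]
  refine le_trans ?_ (BlochSpace.norm_fderiv_le _ hz)
  have hs := one_sub_sq_pos hz
  rw [mem_ball_zero_iff] at hz
  gcongr
  exact (ContinuousLinearMap.le_opNorm _ _).trans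
    (mul_le_of_le_one_right (norm_nonneg _) hz.le)

end Necessity

/-! ### Radial and tangential test functions -/

section TestFunctions

variable {E : Type*} [NormedAddCommGroup E] [InnerProductSpace ℂ E] {a w x : E}

lemma one_sub_norm_le_norm_one_sub_inner (ha : ‖a‖ < 1) (hx : ‖x‖ < 1) :
    1 - ‖x‖ ≤ ‖(1 - inner ℂ a x : ℂ)‖ ∧ 1 - ‖a‖ ≤ ‖(1 - inner ℂ a x : ℂ)‖ := by
  have h1 := norm_inner_le_norm (𝕜 := ℂ) a x
  have h2 := norm_sub_norm_le (1 : ℂ) (inner ℂ a x)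
  rw [norm_one] at h2
  constructor <;> nlinarith [norm_nonneg a, norm_nonneg x]

lemma one_sub_inner_ne_zero (ha : ‖a‖ < 1) (hx : ‖x‖ < 1) : (1 - inner ℂ a x : ℂ) ≠ 0 :=
  norm_pos_iff.mp (by linarith [(one_sub_norm_le_norm_one_sub_inner ha hx).1])

lemma hasFDerivAt_inv_one_sub_inner (ha : ‖a‖ < 1) (hx : ‖x‖ < 1) :
    HasFDerivAt (fun y : E => (1 - inner ℂ a y : ℂ)⁻¹)
      (((1 - inner ℂ a x : ℂ) ^ 2)⁻¹ • innerSL ℂ a) x := by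
  have h1 : HasFDerivAt (fun y : E => (1 - inner ℂ a y : ℂ)) (-(innerSL ℂ a)) x :=
    ((innerSL ℂ a).hasFDerivAt (x := x)).const_sub (1 : ℂ)
  have h := (hasDerivAt_inv (one_sub_inner_ne_zero ha hx)).comp_hasFDerivAt x h1
  refine h.congr_fderiv ?_
  ext v
  simp

/-- Bessel's inequality for two orthogonal vectors that need not be normalised: Cauchy–Schwarz for x
against ⟨x, a⟩a + ⟨x, w⟩w. -/
lemma norm_inner_sq_add_norm_inner_sq_le (ha : ‖a‖ ≤ 1) (hw : ‖w‖ ≤ 1)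
    (haw : inner ℂ a w = 0) (x : E) :
    ‖(inner ℂ a x : ℂ)‖ ^ 2 + ‖(inner ℂ w x : ℂ)‖ ^ 2 ≤ ‖x‖ ^ 2 := by
  set α : ℂ := inner ℂ a x with hα
  set β : ℂ := inner ℂ w x with hβ
  set S : ℝ := ‖α‖ ^ 2 + ‖β‖ ^ 2 with hS
  have h1 : inner ℂ (α • a + β • w) x = ((S : ℝ) : ℂ) := by
    rw [inner_add_left, inner_smul_left, inner_smul_left, ← hα, ← hβ, Complex.conj_mul',
      Complex.conj_mul', hS]
    push_cast
    rfl
  have h2 : ‖α • a + β • w‖ ^ 2 ≤ S := by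
    have h0 : inner ℂ (α • a) (β • w) = 0 := by
      rw [inner_smul_left, inner_smul_right, haw, mul_zero, mul_zero]
    have h := norm_add_sq_eq_norm_sq_add_norm_sq_of_inner_eq_zero _ _ h0
    have ha' : ‖α • a‖ ≤ ‖α‖ := by
      rw [norm_smul]; exact mul_le_of_le_one_right (norm_nonneg _) ha
    have hw' : ‖β • w‖ ≤ ‖β‖ := by
      rw [norm_smul]; exact mul_le_of_le_one_right (norm_nonneg _) hw
    nlinarith [norm_nonneg (α • a), norm_nonneg (β • w)]
  have hS0 : 0 ≤ S := by positivity
  have h3 := norm_inner_le_norm (𝕜 := ℂ) (α • a + β • w) x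
  rw [h1, Complex.norm_real, Real.norm_of_nonneg hS0] at h3
  have h4 : S ^ 2 ≤ S * ‖x‖ ^ 2 := by
    calc S ^ 2 ≤ (‖α • a + β • w‖ * ‖x‖) ^ 2 := by gcongr
      _ = ‖α • a + β • w‖ ^ 2 * ‖x‖ ^ 2 := by ring
      _ ≤ S * ‖x‖ ^ 2 := by gcongr
  rcases hS0.eq_or_lt with h | h
  · rw [← h]; positivity
  · exact le_of_mul_le_mul_left (by linarith) h

/-- With q = |1 - ⟨x, a⟩|, both |⟨x, w⟩|² and 1 - ‖a‖² are at most 2q, the former by Bessel; the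
product is then bounded by AM-GM. This tames the term with (1 - ⟨x, a⟩)⁻² in the derivative of the
tangential test function. -/
lemma norm_inner_mul_sqrt_le (ha : ‖a‖ < 1) (hw : ‖w‖ ≤ 1) (haw : inner ℂ a w = 0)
    (hx : ‖x‖ < 1) :
    ‖(inner ℂ w x : ℂ)‖ * √(1 - ‖a‖ ^ 2) ≤ 2 * ‖(1 - inner ℂ a x : ℂ)‖ := by
  have h1 := norm_inner_sq_add_norm_inner_sq_le ha.le hw haw x
  have h2 := (one_sub_norm_le_norm_one_sub_inner ha hx).2
  have h3 := norm_sub_norm_le (1 : ℂ) (inner ℂ a x)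
  have h4 := norm_inner_le_norm (𝕜 := ℂ) a x
  rw [norm_one] at h3
  set q := ‖(1 - inner ℂ a x : ℂ)‖ with hq
  set α := ‖(inner ℂ a x : ℂ)‖ with hα
  have hα0 : 0 ≤ α := norm_nonneg _
  have hα1 : α ≤ 1 := by nlinarith [norm_nonneg a, norm_nonneg x]
  have h5 : ‖(inner ℂ w x : ℂ)‖ ^ 2 ≤ 2 * q := by nlinarith [norm_nonneg x]
  have h6 : √(1 - ‖a‖ ^ 2) ^ 2 ≤ 2 * q := by
    rw [Real.sq_sqrt (by nlinarith [norm_nonneg a])]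
    nlinarith [norm_nonneg a]
  nlinarith [sq_nonneg (‖(inner ℂ w x : ℂ)‖ - √(1 - ‖a‖ ^ 2))]

/-- The functions `(1 - ‖a‖²) / (1 - ⟨x, a⟩)` form a bounded family in the Bloch space. -/
lemma exists_radial_testFunction (ha : a ∈ ball (0 : E) 1) :
    ∃ f : BlochSpace E, ‖f‖ ≤ 127 ∧
      (∀ x ∈ ball (0 : E) 1, ‖f x‖ ≤ √(1 - ‖a‖ ^ 2) / (1 - ‖x‖)) ∧
      ∀ u, fderiv ℂ f a u = inner ℂ a u / ((1 - ‖a‖ ^ 2 : ℝ) : ℂ) := by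
  have hs := one_sub_sq_pos ha
  have ha1 : ‖a‖ < 1 := by simpa using ha
  set s : ℝ := 1 - ‖a‖ ^ 2 with hsdef
  have hsr : s ≤ √s := Real.le_sqrt_of_sq_le (by nlinarith [sq_nonneg ‖a‖])
  have hsn : ‖((s : ℝ) : ℂ)‖ = s := by rw [Complex.norm_real, Real.norm_of_nonneg hs.le]
  have hder : ∀ x ∈ ball (0 : E) 1, HasFDerivAt (fun y : E => (s : ℂ) * (1 - inner ℂ a y : ℂ)⁻¹)
      ((s : ℂ) • ((1 - inner ℂ a x : ℂ) ^ 2)⁻¹ • innerSL ℂ a) x := fun x hx =>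
    (hasFDerivAt_inv_one_sub_inner ha1 (by simpa using hx)).const_mul _
  have hM : ∀ x ∈ ball (0 : E) 1, (1 - ‖x‖ ^ 2) *
      ‖(s : ℂ) • ((1 - inner ℂ a x : ℂ) ^ 2)⁻¹ • innerSL ℂ a‖ ≤ 4 := by
    intro x hx
    have hx1 : ‖x‖ < 1 := by simpa using hx
    obtain ⟨h1, h2⟩ := one_sub_norm_le_norm_one_sub_inner ha1 hx1
    have hq := norm_pos_iff.mpr (one_sub_inner_ne_zero ha1 hx1)
    rw [norm_smul, norm_smul, hsn, norm_inv, norm_pow, innerSL_apply_norm]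
    set q := ‖(1 - inner ℂ a x : ℂ)‖
    have h3 : 1 - ‖x‖ ^ 2 ≤ 2 * q := by nlinarith [norm_nonneg x]
    have h4 : s ≤ 2 * q := by nlinarith [norm_nonneg a]
    -- The factors 1 - ‖x‖² and 1 - ‖a‖² each absorb one power of q⁻¹.
    calc (1 - ‖x‖ ^ 2) * (s * ((q ^ 2)⁻¹ * ‖a‖)) ≤ (2 * q) * (2 * q * ((q ^ 2)⁻¹ * 1)) := by
          gcongr
      _ = 4 := by field_simp; norm_num
  obtain ⟨f, hf, hfx, hfd⟩ := BlochSpace.exists_of_hasFDerivAt hder hM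
  refine ⟨f, hf.trans ?_, ?_, ?_⟩
  · rw [inner_zero_right, sub_zero, inv_one, mul_one, hsn]
    nlinarith [sq_nonneg ‖a‖]
  · intro x hx
    have hx1 : ‖x‖ < 1 := by simpa using hx
    rw [hfx x hx, norm_mul, norm_inv, hsn, ← div_eq_mul_inv]
    have : 0 < 1 - ‖x‖ := by linarith
    gcongr
    exact (one_sub_norm_le_norm_one_sub_inner ha1 hx1).1
  · intro u
    have h1 : (1 - inner ℂ a a : ℂ) = (s : ℂ) := by
      rw [inner_self_eq_norm_sq_to_K, hsdef]
      push_cast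
      rfl
    have h2 : (s : ℂ) ≠ 0 := by exact_mod_cast hs.ne'
    rw [hfd a ha, h1]
    simp only [smul_apply, innerSL_apply_apply, smul_eq_mul]
    field_simp

/-- For `w ⟂ a` with `‖w‖ ≤ 1`, the functions `√(1 - ‖a‖²) ⟨x, w⟩ / (1 - ⟨x, a⟩)` form a bounded
family in the Bloch space. -/
lemma exists_tangential_testFunction (ha : a ∈ ball (0 : E) 1) (hw : ‖w‖ ≤ 1)
    (haw : inner ℂ a w = 0) :
    ∃ f : BlochSpace E, ‖f‖ ≤ 126 ∧
      (∀ x ∈ ball (0 : E) 1, ‖f x‖ ≤ √(1 - ‖a‖ ^ 2) / (1 - ‖x‖)) ∧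
      ∀ u, fderiv ℂ f a u = inner ℂ w u / ((√(1 - ‖a‖ ^ 2) : ℝ) : ℂ) := by
  have hs := one_sub_sq_pos ha
  have ha1 : ‖a‖ < 1 := by simpa using ha
  set r : ℝ := √(1 - ‖a‖ ^ 2) with hrdef
  have hr : 0 < r := Real.sqrt_pos.mpr hs
  have hr1 : r ≤ 1 := Real.sqrt_le_one.mpr (by linarith [sq_nonneg ‖a‖])
  have hrn : ‖((r : ℝ) : ℂ)‖ = r := by rw [Complex.norm_real, Real.norm_of_nonneg hr.le]
  have hder : ∀ x ∈ ball (0 : E) 1,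
      HasFDerivAt (fun y : E => (r : ℂ) * ((inner ℂ w y : ℂ) * (1 - inner ℂ a y : ℂ)⁻¹))
        ((r : ℂ) • ((inner ℂ w x : ℂ) • ((1 - inner ℂ a x : ℂ) ^ 2)⁻¹ • innerSL ℂ a
          + (1 - inner ℂ a x : ℂ)⁻¹ • innerSL ℂ w)) x := fun x hx =>
    (((innerSL ℂ w).hasFDerivAt (x := x)).mul
      (hasFDerivAt_inv_one_sub_inner ha1 (by simpa using hx))).const_mul _
  have hM : ∀ x ∈ ball (0 : E) 1, (1 - ‖x‖ ^ 2) *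
      ‖(r : ℂ) • ((inner ℂ w x : ℂ) • ((1 - inner ℂ a x : ℂ) ^ 2)⁻¹ • innerSL ℂ a
        + (1 - inner ℂ a x : ℂ)⁻¹ • innerSL ℂ w)‖ ≤ 6 := by
    intro x hx
    have hx1 : ‖x‖ < 1 := by simpa using hx
    obtain ⟨h1, h2⟩ := one_sub_norm_le_norm_one_sub_inner ha1 hx1
    have hq := norm_pos_iff.mpr (one_sub_inner_ne_zero ha1 hx1)
    have h5 := norm_inner_mul_sqrt_le ha1 hw haw hx1
    rw [← hrdef] at h5
    rw [norm_smul, hrn]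
    have h6 : ‖(inner ℂ w x : ℂ) • ((1 - inner ℂ a x : ℂ) ^ 2)⁻¹ • innerSL ℂ a
        + (1 - inner ℂ a x : ℂ)⁻¹ • innerSL ℂ w‖ ≤
        ‖(inner ℂ w x : ℂ)‖ * ((‖(1 - inner ℂ a x : ℂ)‖ ^ 2)⁻¹ * ‖a‖)
          + ‖(1 - inner ℂ a x : ℂ)‖⁻¹ * ‖w‖ := by
      refine (norm_add_le _ _).trans (le_of_eq ?_)
      rw [norm_smul, norm_smul, norm_smul, norm_inv, norm_pow, innerSL_apply_norm,
        innerSL_apply_norm, norm_inv]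
    set q := ‖(1 - inner ℂ a x : ℂ)‖
    have h3 : 1 - ‖x‖ ^ 2 ≤ 2 * q := by nlinarith [norm_nonneg x]
    refine (mul_le_mul h3 (mul_le_mul_of_nonneg_left h6 hr.le) (by positivity)
      (by positivity)).trans ?_
    calc 2 * q * (r * (‖(inner ℂ w x : ℂ)‖ * ((q ^ 2)⁻¹ * ‖a‖) + q⁻¹ * ‖w‖))
        = 2 * q * ((‖(inner ℂ w x : ℂ)‖ * r) * ((q ^ 2)⁻¹ * ‖a‖) + r * (q⁻¹ * ‖w‖)) := by ring
      _ ≤ 2 * q * ((2 * q) * ((q ^ 2)⁻¹ * 1) + 1 * (q⁻¹ * 1)) := by gcongr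
      _ = 6 := by field_simp; norm_num
  obtain ⟨f, hf, hfx, hfd⟩ := BlochSpace.exists_of_hasFDerivAt hder hM
  refine ⟨f, hf.trans ?_, ?_, ?_⟩
  · rw [inner_zero_right, zero_mul, mul_zero, norm_zero]
    norm_num
  · intro x hx
    have hx1 : ‖x‖ < 1 := by simpa using hx
    have h1 : ‖(inner ℂ w x : ℂ)‖ ≤ 1 := (norm_inner_le_norm w x).trans
      (mul_le_one₀ hw (norm_nonneg _) hx1.le)
    have : 0 < 1 - ‖x‖ := by linarith
    rw [hfx x hx, norm_mul, norm_mul, norm_inv, hrn]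
    calc r * (‖(inner ℂ w x : ℂ)‖ * ‖(1 - inner ℂ a x : ℂ)‖⁻¹) ≤ r * (1 * (1 - ‖x‖)⁻¹) := by
          gcongr
          exact (one_sub_norm_le_norm_one_sub_inner ha1 hx1).1
      _ = r / (1 - ‖x‖) := by rw [one_mul, div_eq_mul_inv]
  · intro u
    have h1 : (1 - inner ℂ a a : ℂ) = (r : ℂ) ^ 2 := by
      have : r ^ 2 = 1 - ‖a‖ ^ 2 := Real.sq_sqrt hs.le
      rw [inner_self_eq_norm_sq_to_K, ← Complex.ofReal_pow, this]
      push_cast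
      rfl
    have h2 : (r : ℂ) ≠ 0 := by exact_mod_cast hr.ne'
    have h3 : inner ℂ w a = 0 := inner_eq_zero_symm.mp haw
    rw [hfd a ha, h1, h3]
    simp only [smul_apply, add_apply, innerSL_apply_apply, smul_eq_mul, zero_mul, zero_add]
    field_simp

end TestFunctions

/-! ### The two limits from compactness -/

section Limits

variable {E : Type*} [NormedAddCommGroup E] [InnerProductSpace ℂ E] {φ : E → E}
  {hφ : DifferentiableOn ℂ φ (ball 0 1)} {hmaps : Set.MapsTo φ (ball 0 1) (ball 0 1)}

/-- The radial test function at a = φ z has derivative ⟨u, a⟩/(1 - ‖a‖²) at a, so with u = Rφ(z) the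
quotient in (ii) is at most 3‖C_φ f‖. -/
theorem tendstoZero_inner_of_isCompactOperator
    (hC : IsCompactOperator (compositionOperator φ hφ hmaps)) :
    TendstoZeroAtBoundary φ fun z =>
      (1 - ‖z‖ ^ 2) * ‖(inner ℂ (φ z) (radialDeriv φ z) : ℂ)‖ / (1 - ‖φ z‖ ^ 2) := by
  intro ε hε
  obtain ⟨δ, hδ, H⟩ := exists_norm_compositionOperator_lt hC 127 (ε := ε / 3) (by positivity)
  refine ⟨δ, hδ, fun z hz hzδ => ?_⟩
  have hs := one_sub_sq_pos (hmaps hz)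
  have hd := one_sub_sq_pos hz
  obtain ⟨f, hf, hfx, hfd⟩ := exists_radial_testFunction (hmaps hz)
  have h1 := H _ (hmaps hz) hzδ f hf hfx
  have h2 := norm_fderiv_radial_le_compositionOperator (hφ := hφ) (hmaps := hmaps) f hz
  rw [hfd, norm_div, Complex.norm_real, Real.norm_of_nonneg hs.le, ← mul_div_assoc] at h2
  rw [abs_of_nonneg (by positivity)]
  linarith

/-- Rφ(z) is split along and across φ z. The part along φ z is handled by (ii), because 1 - ‖φ z‖² ≤
√(1 - ‖φ z‖²); the part across it by the tangential test function. -/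
theorem tendstoZero_norm_of_isCompactOperator
    (hC : IsCompactOperator (compositionOperator φ hφ hmaps)) :
    TendstoZeroAtBoundary φ fun z =>
      (1 - ‖z‖ ^ 2) * ‖radialDeriv φ z‖ / √(1 - ‖φ z‖ ^ 2) := by
  intro ε hε
  obtain ⟨δ₁, hδ₁, H₁⟩ := tendstoZero_inner_of_isCompactOperator hC (ε / 4) (by positivity)
  obtain ⟨δ₂, hδ₂, H₂⟩ := exists_norm_compositionOperator_lt hC 126 (ε := ε / 6) (by positivity)
  refine ⟨max (max δ₁ δ₂) (1 / 2), max_lt (max_lt hδ₁ hδ₂) (by norm_num), fun z hz hzδ => ?_⟩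
  have hz1 : δ₁ < ‖φ z‖ := ((le_max_left _ _).trans (le_max_left _ _)).trans_lt hzδ
  have hz2 : δ₂ < ‖φ z‖ := ((le_max_right _ _).trans (le_max_left _ _)).trans_lt hzδ
  have hz3 : 1 / 2 < ‖φ z‖ := (le_max_right _ _).trans_lt hzδ
  have hs := one_sub_sq_pos (hmaps hz)
  have hr := Real.sqrt_pos.mpr hs
  have hd := one_sub_sq_pos hz
  have hsr : 1 - ‖φ z‖ ^ 2 ≤ √(1 - ‖φ z‖ ^ 2) :=
    Real.le_sqrt_of_sq_le (by nlinarith [sq_nonneg ‖φ z‖])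
  have h1 := (abs_lt.mp (H₁ z hz hz1)).2
  set u := radialDeriv φ z with hu
  set v := u - lineProj (φ z) u with hv
  have hav : inner ℂ (φ z) v = 0 := inner_sub_lineProj _ _
  -- The unit vector that makes |⟨u, w⟩| equal to ‖v‖; for v = 0 it is 0, which is why only `‖w‖ ≤
  -- 1` is required.
  set w : E := ((‖v‖⁻¹ : ℝ) : ℂ) • v with hw
  have hw1 : ‖w‖ ≤ 1 := by
    rw [hw, norm_smul, Complex.norm_real, norm_inv, norm_norm]
    exact inv_mul_le_one
  have haw : inner ℂ (φ z) w = 0 := by rw [hw, inner_smul_right, hav, mul_zero]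
  have hwu : ‖(inner ℂ w u : ℂ)‖ = ‖v‖ := by
    have h2 : u = v + lineProj (φ z) u := by rw [hv]; abel
    have h3 : inner ℂ v (lineProj (φ z) u) = 0 := by
      rw [lineProj_apply, inner_smul_right, inner_eq_zero_symm.mp hav, mul_zero]
    rw [hw, inner_smul_left, norm_mul, RCLike.norm_conj, Complex.norm_real, norm_inv, norm_norm, h2,
      inner_add_right, h3, add_zero, inner_self_eq_norm_sq_to_K, norm_pow]
    simp only [Complex.coe_algebraMap, Complex.norm_real, norm_norm]
    by_cases h0 : ‖v‖ = 0
    · simp [h0]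
    · field_simp
  obtain ⟨f, hf, hfx, hfd⟩ := exists_tangential_testFunction (hmaps hz) hw1 haw
  have h2 := H₂ _ (hmaps hz) hz2 f hf hfx
  have h3 := norm_fderiv_radial_le_compositionOperator (hφ := hφ) (hmaps := hmaps) f hz
  rw [hfd, norm_div, Complex.norm_real, Real.norm_of_nonneg hr.le, hwu, ← mul_div_assoc] at h3
  have h4 := norm_lineProj_le_of_half_le (u := u) hz3.le
  have h5 : ‖u‖ ≤ ‖lineProj (φ z) u‖ + ‖v‖ := by
    have : u = lineProj (φ z) u + v := by rw [hv]; abel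
    calc ‖u‖ = ‖lineProj (φ z) u + v‖ := by rw [← this]
      _ ≤ _ := norm_add_le _ _
  rw [abs_of_nonneg (by positivity)]
  calc (1 - ‖z‖ ^ 2) * ‖u‖ / √(1 - ‖φ z‖ ^ 2)
      ≤ (1 - ‖z‖ ^ 2) * (2 * ‖(inner ℂ (φ z) u : ℂ)‖ + ‖v‖) / √(1 - ‖φ z‖ ^ 2) := by
        gcongr
        linarith
    _ = 2 * ((1 - ‖z‖ ^ 2) * ‖(inner ℂ (φ z) u : ℂ)‖ / √(1 - ‖φ z‖ ^ 2))
        + (1 - ‖z‖ ^ 2) * ‖v‖ / √(1 - ‖φ z‖ ^ 2) := by ring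
    _ ≤ 2 * ((1 - ‖z‖ ^ 2) * ‖(inner ℂ (φ z) u : ℂ)‖ / (1 - ‖φ z‖ ^ 2))
        + (1 - ‖z‖ ^ 2) * ‖v‖ / √(1 - ‖φ z‖ ^ 2) := by gcongr
    _ < ε := by linarith

end Limits

end BlochBall

theorem mainTheorem3 {E : Type*} [NormedAddCommGroup E] [InnerProductSpace ℂ E] [CompleteSpace E]
    (φ : E → E) (hφ : DifferentiableOn ℂ φ (Metric.ball 0 1))
    (hmaps : Set.MapsTo φ (Metric.ball 0 1) (Metric.ball 0 1))
    (hφ_compact : ∀ δ : ℝ, 0 < δ → δ < 1 →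
      IsCompact (closure (φ '' {z ∈ Metric.ball (0 : E) 1 | ‖φ z‖ ≤ δ})))
    (hR_compact : ∀ δ : ℝ, 0 < δ → δ < 1 →
      IsCompact (closure ((fun z => (1 - ‖z‖ ^ 2) • BlochBall.radialDeriv φ z) ''
        {z ∈ Metric.ball (0 : E) 1 | ‖φ z‖ ≤ δ}))) :
    IsCompactOperator (BlochBall.compositionOperator φ hφ hmaps) ↔
      BlochBall.TendstoZeroAtBoundary φ (fun z =>
        (1 - ‖z‖ ^ 2) * ‖BlochBall.radialDeriv φ z‖ / √(1 - ‖φ z‖ ^ 2)) ∧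
      BlochBall.TendstoZeroAtBoundary φ (fun z =>
        (1 - ‖z‖ ^ 2) * ‖(inner ℂ (φ z) (BlochBall.radialDeriv φ z) : ℂ)‖ /
          (1 - ‖φ z‖ ^ 2)) :=
  ⟨fun hC => ⟨BlochBall.tendstoZero_norm_of_isCompactOperator hC,
      BlochBall.tendstoZero_inner_of_isCompactOperator hC⟩,
    fun h => BlochBall.isCompactOperator_compositionOperator hφ_compact hR_compact h.1 h.2⟩
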